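/- Define the Cayley--Dickson algebras by $A_0=\mathbb{R}$ and $A_n=A_{n-1}\times A_{n-1}$ for $n\ge 1$, with componentwise real vector space structure, conjugation $(a,b)^*=(a^*,-b)$ (the identity on $A_0$) and multiplication $(a,b)(c,d)=(ac-d^*b,\;da+bc^*)$. Let $\|a\|=\sqrt{\operatorname{Re}(aa^*)}$, where $\operatorname{Re}(x)=\tfrac12(x+x^*)$ is regarded as a real number. For $0\neq a\in A_n$ let $M_a=\frac{1}{\|a\|^2}L_{a^*}L_a$, an $\mathbb{R}$-linear endomorphism of $A_n$, where $L_b(x)=bx$, and let $\operatorname{Eig}_\lambda(a)$ be the $\lambda$-eigenspace of $M_a$. The multiplicity of $\lambda$ is $\dim_{\mathbb{R}}\operatorname{Eig}_\lambda(a)$. Call a non-zero $a\in A_n$ a top-dimensional zero-divisor if $\dim_{\mathbb R}\operatorname{Eig}_0(a)=2^n-4n+4$. (For $n\ge4$ such an $a$ is indeed a zero-divisor, since this dimension is positive. For $n=3$ the condition says that $\operatorname{Eig}_0(a)=0$.) **Theorem.** Let $n\ge 3$ and let $a\in A_n$ be a top-dimensional zero-divisor. Then the eigenvalues of $M_a$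 are exactly the numbers $2^k$ with $0\le k\le n-3$, together with $0$ when $n\ge 4$. Moreover, the multiplicity of $0$ is $2^n-4n+4$ (which is $0$ when $n=3$), the multiplicity of $1$ is $8$, and every other eigenvalue has multiplicity $4$. -/

import Mathlib

namespace CayleyDickson

/-- The underlying set of the Cayley-Dickson algebra `A_n`:
`A_0 = ℝ` and `A_{n+1} = A_n × A_n`. -/
def A : ℕ → Type
  | 0 => ℝ
  | n + 1 => A n × A n

/-- The additive structure is componentwise. -/
@[reducible] noncomputable def addCommGroupA : (n : ℕ) → AddCommGroup (A n)
  | 0 => inferInstanceAs (AddCommGroup ℝ)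
  | n + 1 =>
    letI := addCommGroupA n
    inferInstanceAs (AddCommGroup (A n × A n))

noncomputable instance (n : ℕ) : AddCommGroup (A n) := addCommGroupA n

/-- The real scalar multiplication is componentwise. -/
@[reducible] noncomputable def moduleA : (n : ℕ) → Module ℝ (A n)
  | 0 => inferInstanceAs (Module ℝ ℝ)
  | n + 1 =>
    letI := moduleA n
    inferInstanceAs (Module ℝ (A n × A n))

noncomputable instance (n : ℕ) : Module ℝ (A n) := moduleA n

/-- The pair `(a, b)` of elements of `A_n`, as an element of `A_{n+1}`. -/
def pair {n : ℕ} (a b : A n) : A (n + 1) := (a, b)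

/-- The first component of an element of `A_{n+1}`. -/
def left {n : ℕ} (x : A (n + 1)) : A n := Prod.fst (α := A n) (β := A n) x

/-- The second component of an element of `A_{n+1}`. -/
def right {n : ℕ} (x : A (n + 1)) : A n := Prod.snd (α := A n) (β := A n) x

/-- Conjugation: the identity on `A_0 = ℝ`, and `(a, b)^* = (a^*, -b)` on `A_{n+1}`. -/
noncomputable def conj : {n : ℕ} → A n → A n
  | 0, x => x
  | _ + 1, x => pair (conj (left x)) (-right x)

/-- Multiplication: the usual one on `A_0 = ℝ`, and
`(a, b)(c, d) = (ac - d^* b, da + b c^*)` on `A_{n+1}`. -/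
noncomputable def mul : {n : ℕ} → A n → A n → A n
  | 0, x, y => (show ℝ from x) * (show ℝ from y)
  | _ + 1, x, y =>
    pair (mul (left x) (left y) - mul (conj (right y)) (right x))
      (mul (right y) (left x) + mul (right x) (conj (left y)))

/-- The unit element: `1 ∈ ℝ = A_0`, and `(1, 0) ∈ A_{n+1}`. -/
noncomputable def one : (n : ℕ) → A n
  | 0 => (1 : ℝ)
  | n + 1 => pair (one n) 0

/-- The real part, as a real number; `half_smul_add_conj` below identifies it
with `(x + x^*) / 2`. -/
def re : {n : ℕ} → A n → ℝ
  | 0, x => x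
  | _ + 1, x => re (left x)

section Basic

variable {n : ℕ}

theorem ext_pair {x y : A (n + 1)} (h1 : left x = left y) (h2 : right x = right y) : x = y :=
  Prod.ext (α := A n) (β := A n) h1 h2

theorem left_pair (a b : A n) : left (pair a b) = a := rfl
theorem right_pair (a b : A n) : right (pair a b) = b := rfl
theorem left_zero : left (0 : A (n + 1)) = 0 := rfl
theorem right_zero : right (0 : A (n + 1)) = 0 := rfl
theorem left_add (x y : A (n + 1)) : left (x + y) = left x + left y := rfl
theorem right_add (x y : A (n + 1)) : right (x + y) = right x + right y := rfl
theorem left_smul (r : ℝ) (x : A (n + 1)) : left (r • x) = r • left x := rfl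
theorem right_smul (r : ℝ) (x : A (n + 1)) : right (r • x) = r • right x := rfl

theorem conj_succ (x : A (n + 1)) : conj x = pair (conj (left x)) (-right x) := rfl

theorem mul_succ (x y : A (n + 1)) :
    mul x y = pair (mul (left x) (left y) - mul (conj (right y)) (right x))
      (mul (right y) (left x) + mul (right x) (conj (left y))) := rfl

theorem conj_add {n : ℕ} (x y : A n) : conj (x + y) = conj x + conj y := by
  induction n with
  | zero => rfl
  | succ n ih =>
    apply ext_pair <;>
      simp only [conj_succ, left_pair, right_pair, left_add, right_add, ih] <;> abel

theorem conj_smul {n : ℕ} (r : ℝ) (x : A n) : conj (r • x) = r • conj x := by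
  induction n with
  | zero => rfl
  | succ n ih =>
    apply ext_pair <;>
      simp only [conj_succ, left_pair, right_pair, left_smul, right_smul, ih, smul_neg]

theorem add_mul' {n : ℕ} (x y z : A n) : mul (x + y) z = mul x z + mul y z ∧
    mul z (x + y) = mul z x + mul z y := by
  induction n with
  | zero => exact ⟨_root_.add_mul (R := ℝ) x y z, _root_.mul_add (R := ℝ) z x y⟩
  | succ n ih =>
    have h1 : ∀ a b c : A n, mul (a + b) c = mul a c + mul b c := fun a b c => (ih a b c).1
    have h2 : ∀ a b c : A n, mul c (a + b) = mul c a + mul c b := fun a b c => (ih a b c).2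
    constructor <;> apply ext_pair <;>
      simp only [mul_succ, left_pair, right_pair, left_add, right_add, conj_add, h1, h2] <;> abel

theorem smul_mul' {n : ℕ} (r : ℝ) (x y : A n) : mul (r • x) y = r • mul x y ∧
    mul x (r • y) = r • mul x y := by
  induction n with
  | zero => exact ⟨smul_mul_assoc (α := ℝ) (β := ℝ) r x y, mul_smul_comm (α := ℝ) (β := ℝ) r x y⟩
  | succ n ih =>
    have h1 : ∀ a b : A n, mul (r • a) b = r • mul a b := fun a b => (ih a b).1
    have h2 : ∀ a b : A n, mul a (r • b) = r • mul a b := fun a b => (ih a b).2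
    constructor <;> apply ext_pair <;>
      simp only [mul_succ, left_pair, right_pair, left_smul, right_smul, conj_smul, h1, h2,
        smul_sub, smul_add]

/-- The real part of `x`, as an element of `A_n`, is `(x + x^*) / 2`. -/
theorem half_smul_add_conj {n : ℕ} (x : A n) : (1 / 2 : ℝ) • (x + conj x) = re x • one n := by
  induction n with
  | zero =>
    have h : ∀ t : ℝ, (1 / 2 : ℝ) • (t + t) = t • (1 : ℝ) := fun t => by
      simp only [smul_eq_mul]; ring
    exact h x
  | succ n ih =>
    apply ext_pair
    · exact ih (left x)
    · simp only [right_smul, right_add, conj_succ, right_pair, one, add_neg_cancel, smul_zero]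

end Basic

/-- The real inner product `⟨a, b⟩_ℝ = Re (a b^*)`. -/
noncomputable def innerR {n : ℕ} (a b : A n) : ℝ := re (mul a (conj b))

/-- The norm `‖a‖ = √⟨a, a⟩_ℝ`. -/
noncomputable def norm {n : ℕ} (a : A n) : ℝ := Real.sqrt (innerR a a)

/-- Left multiplication `L_a`, as a real linear map. -/
noncomputable def L {n : ℕ} (a : A n) : A n →ₗ[ℝ] A n where
  toFun x := mul a x
  map_add' x y := (add_mul' x y a).2
  map_smul' r x := (smul_mul' r a x).2

/-- The real linear map `M_a = ‖a‖⁻² L_{a^*} L_a` (for `a ≠ 0`). -/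
noncomputable def M {n : ℕ} (a : A n) : A n →ₗ[ℝ] A n :=
  (1 / norm a ^ 2) • (L (conj a) ∘ₗ L a)

/-- The `lam`-eigenspace of `a`, that is, of `M_a`. -/
noncomputable def Eig {n : ℕ} (lam : ℝ) (a : A n) : Submodule ℝ (A n) :=
  Module.End.eigenspace (M a) lam

/-- Top-dimensional zero-divisors of `A_n`: nonzero elements whose `0`-eigenspace has dimension
`2^n - 4n + 4`. For `n ≥ 4` this dimension is positive, so that such an element is a zero-divisor;
for `n = 3` the dimension is `0`. -/
def IsTopDimZeroDivisor {n : ℕ} (a : A n) : Prop :=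
  a ≠ 0 ∧ (Module.finrank ℝ (Eig 0 a) : ℤ) = 2 ^ n - 4 * n + 4

end CayleyDickson

/-! Trace associativity makes `L_{a^*}` the adjoint of `L_a`, so `M_a` is self-adjoint and its
distinct eigenspaces are independent. With `n = m + 3` it then suffices to prove lower bounds:
dimension at least 8 for eigenvalue 1 and at least 4 for each of `2, 4, ..., 2^m`. Together with the
kernel they already give `(2^n - 4n + 4) + 8 + 4m = 2^n`, so every bound is sharp and no other
eigenvalue fits.

The lower bounds come from the structure of a top-dimensional `a` in `A_n`, `n ≥ 5`. Let `i = (0,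
1)` in `A_{n-1}` and `C = span(1, i)`. Bounding annihilators from above forces `a = (p, ±ip)`,
written `br ε p`, with `p ⟂ C`. Indeed, if a component of `a` is not orthogonal to `C`, the kernel
injects into the imaginary elements of `A_{n-1}`; if `a = br 1 p + br (-1) q` with `p, q ≠ 0`, its
kernel is controlled by those of `p` and `q` up to 6 dimensions. Both are too small. For `a = br ε
p` the bound on the kernel is attained only if `p` is again top-dimensional
(`exists_br_of_finrank_Eig_zero`, `finrank_ker_br`).

Passing from `p` to `br ε p` doubles eigenvalues: `(br ε p)(br ε x) = br ε (2px)` when `x` and `px`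
are orthogonal to `C`, while the squared norm doubles. For eigenvalues other than 1 this
orthogonality is automatic; the 1-eigenspace loses at most 4 dimensions, so its 8 leave 4 for
eigenvalue 2. A fresh 8-dimensional part with eigenvalue 1 is spanned by `C × C` and its image under
`L_a`.

The induction starts at `n = 4`, where alternativity of the octonions `A_3` gives `Eig_1` dimension
at least 8 and `(x, y) ↦ (x, -y)` carries `Eig_0` into `Eig_2`. For `n = 3`, alternativity gives
`M_a = 1`. -/

namespace CayleyDickson

/-! ### Conjugation, the trace form and adjoints -/

section Algebra

variable {n : ℕ}

theorem add_mul (x y z : A n) : mul (x + y) z = mul x z + mul y z := (add_mul' x y z).1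
theorem mul_add (z x y : A n) : mul z (x + y) = mul z x + mul z y := (add_mul' x y z).2
theorem smul_mul (r : ℝ) (x y : A n) : mul (r • x) y = r • mul x y := (smul_mul' r x y).1
theorem mul_smul (r : ℝ) (x y : A n) : mul x (r • y) = r • mul x y := (smul_mul' r x y).2

theorem neg_mul (x y : A n) : mul (-x) y = -mul x y := by
  rw [← neg_one_smul ℝ x, smul_mul, neg_one_smul]
theorem mul_neg (x y : A n) : mul x (-y) = -mul x y := by
  rw [← neg_one_smul ℝ y, mul_smul, neg_one_smul]
theorem zero_mul (x : A n) : mul 0 x = 0 := by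
  rw [← zero_smul ℝ (0 : A n), smul_mul, zero_smul, zero_smul]
theorem mul_zero (x : A n) : mul x 0 = 0 := by
  rw [← zero_smul ℝ (0 : A n), mul_smul, zero_smul, zero_smul]
theorem sub_mul (x y z : A n) : mul (x - y) z = mul x z - mul y z := by
  rw [sub_eq_add_neg, add_mul, neg_mul, ← sub_eq_add_neg]
theorem mul_sub (z x y : A n) : mul z (x - y) = mul z x - mul z y := by
  rw [sub_eq_add_neg, mul_add, mul_neg, ← sub_eq_add_neg]

theorem left_neg (x : A (n + 1)) : left (-x) = -left x := rfl
theorem right_neg (x : A (n + 1)) : right (-x) = -right x := rfl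
theorem left_sub (x y : A (n + 1)) : left (x - y) = left x - left y := rfl
theorem right_sub (x y : A (n + 1)) : right (x - y) = right x - right y := rfl

theorem conj_neg (x : A n) : conj (-x) = -conj x := by
  rw [← neg_one_smul ℝ x, conj_smul, neg_one_smul]
theorem conj_zero : conj (0 : A n) = 0 := by
  rw [← zero_smul ℝ (0 : A n), conj_smul, zero_smul, zero_smul]
theorem conj_sub (x y : A n) : conj (x - y) = conj x - conj y := by
  rw [sub_eq_add_neg, conj_add, conj_neg, ← sub_eq_add_neg]

theorem conj_conj {n : ℕ} (x : A n) : conj (conj x) = x := by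
  induction n with
  | zero => rfl
  | succ n ih =>
    apply ext_pair <;> simp only [conj_succ, left_pair, right_pair, ih, neg_neg]

theorem conj_one {n : ℕ} : conj (one n) = one n := by
  induction n with
  | zero => rfl
  | succ n ih => apply ext_pair <;> simp only [conj_succ, one, left_pair, right_pair, ih, neg_zero]

theorem one_mul_and_mul_one {n : ℕ} (x : A n) : mul (one n) x = x ∧ mul x (one n) = x := by
  induction n with
  | zero => exact ⟨_root_.one_mul (M := ℝ) x, _root_.mul_one (M := ℝ) x⟩
  | succ n ih =>
    constructor <;> apply ext_pair <;>
      simp only [mul_succ, one, left_pair, right_pair, conj_zero, conj_one, mul_zero, zero_mul,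
        (ih _).1, (ih _).2, sub_zero, add_zero, zero_add]

theorem one_mul (x : A n) : mul (one n) x = x := (one_mul_and_mul_one x).1
theorem mul_one (x : A n) : mul x (one n) = x := (one_mul_and_mul_one x).2

theorem conj_mul {n : ℕ} (x y : A n) : conj (mul x y) = mul (conj y) (conj x) := by
  induction n with
  | zero => exact mul_comm (G := ℝ) x y
  | succ n ih =>
    apply ext_pair <;>
      simp only [conj_succ, mul_succ, left_pair, right_pair, conj_sub, ih, conj_conj, conj_neg,
        mul_neg, neg_mul, neg_neg, neg_add] <;> abel

theorem re_succ (x : A (n + 1)) : re x = re (left x) := rfl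

theorem re_add {n : ℕ} (x y : A n) : re (x + y) = re x + re y := by
  induction n with
  | zero => rfl
  | succ n ih => exact ih _ _

theorem re_smul {n : ℕ} (r : ℝ) (x : A n) : re (r • x) = r * re x := by
  induction n with
  | zero => rfl
  | succ n ih => exact ih _

theorem re_neg (x : A n) : re (-x) = -re x := by
  rw [← neg_one_smul ℝ x, re_smul, neg_one_mul]
theorem re_zero : re (0 : A n) = 0 := by
  rw [← zero_smul ℝ (0 : A n), re_smul, MulZeroClass.zero_mul]
theorem re_sub (x y : A n) : re (x - y) = re x - re y := by
  rw [sub_eq_add_neg, re_add, re_neg, ← sub_eq_add_neg]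

theorem re_one {n : ℕ} : re (one n) = 1 := by
  induction n with
  | zero => rfl
  | succ n ih => exact ih

theorem re_conj {n : ℕ} (x : A n) : re (conj x) = re x := by
  induction n with
  | zero => rfl
  | succ n ih => exact ih _

theorem add_conj (x : A n) : x + conj x = (2 * re x) • one n := by
  rw [SemigroupAction.mul_smul, ← half_smul_add_conj, ← SemigroupAction.mul_smul]
  norm_num

theorem conj_eq_neg {x : A n} (h : re x = 0) : conj x = -x := by
  have := add_conj x
  rw [h, MulZeroClass.mul_zero, zero_smul] at this
  exact (neg_eq_of_add_eq_zero_right this).symm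

theorem re_mul_comm {n : ℕ} (x y : A n) : re (mul x y) = re (mul y x) := by
  induction n with
  | zero => exact mul_comm (G := ℝ) x y
  | succ n ih =>
    have h : re (mul (conj (right y)) (right x)) = re (mul (conj (right x)) (right y)) := by
      rw [← re_conj, conj_mul, conj_conj]
    simp only [re_succ, mul_succ, left_pair, re_sub, h, ih (left x)]

/-- The product is not associative, but its real part is. This is what makes `L_{a^*}` and right
multiplication by `a^*` adjoints. -/
theorem re_mul_assoc {n : ℕ} (x y z : A n) : re (mul (mul x y) z) = re (mul x (mul y z)) := by
  induction n with
  | zero => exact mul_assoc (G := ℝ) x y z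
  | succ n ih =>
    simp only [re_succ, mul_succ, left_pair, right_pair, re_sub, sub_mul, mul_sub, mul_add, re_add,
      conj_add, conj_mul, conj_conj, add_mul]
    have h1 : ∀ a b c : A n, re (mul a (mul b c)) = re (mul (mul b c) a) := fun a b c =>
      re_mul_comm _ _
    have h2 := re_mul_comm (mul (conj (right y)) (right x)) (left z)
    have h3 := re_mul_comm (left x) (mul (conj (right z)) (right y))
    have h4 := re_mul_comm (conj (right z)) (mul (right x) (conj (left y)))
    have h5 := re_mul_comm (mul (conj (left y)) (conj (right z))) (right x)
    rw [h2, h3, h4, h5, ih, ih, ih, ih]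
    ring

theorem innerR_succ (x y : A (n + 1)) :
    innerR x y = innerR (left x) (left y) + innerR (right x) (right y) := by
  simp only [innerR, conj_succ, re_succ, mul_succ, left_pair, right_pair, conj_neg, neg_mul,
    sub_neg_eq_add, re_add, re_mul_comm (conj (right y))]

theorem innerR_smul_left (r : ℝ) (x y : A n) : innerR (r • x) y = r * innerR x y := by
  simp only [innerR, smul_mul, re_smul]
theorem innerR_smul_right (r : ℝ) (x y : A n) : innerR x (r • y) = r * innerR x y := by
  simp only [innerR, conj_smul, mul_smul, re_smul]
theorem innerR_zero_left (x : A n) : innerR 0 x = 0 := by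
  simp only [innerR, zero_mul, re_zero]
theorem innerR_zero_right (x : A n) : innerR x 0 = 0 := by
  simp only [innerR, conj_zero, mul_zero, re_zero]

theorem innerR_one_right (x : A n) : innerR x (one n) = re x := by
  rw [innerR, conj_one, mul_one]

theorem innerR_self_nonneg {n : ℕ} (x : A n) : 0 ≤ innerR x x := by
  induction n with
  | zero => exact mul_self_nonneg (R := ℝ) x
  | succ n ih =>
    rw [innerR_succ]
    exact add_nonneg (ih _) (ih _)

theorem innerR_self_eq_zero {n : ℕ} {x : A n} : innerR x x = 0 ↔ x = 0 := by
  induction n with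
  | zero => exact mul_self_eq_zero (M₀ := ℝ)
  | succ n ih =>
    rw [innerR_succ, add_eq_zero_iff_of_nonneg (innerR_self_nonneg _) (innerR_self_nonneg _),
      ih, ih]
    exact ⟨fun h => ext_pair h.1 h.2, fun h => h ▸ ⟨rfl, rfl⟩⟩

theorem innerR_conj_conj {n : ℕ} (x : A n) : innerR (conj x) (conj x) = innerR x x := by
  rw [innerR, innerR, conj_conj, re_mul_comm]

theorem innerR_self_ne_zero {x : A n} (h : x ≠ 0) : innerR x x ≠ 0 :=
  fun h' => h (innerR_self_eq_zero.1 h')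

theorem norm_sq (x : A n) : norm x ^ 2 = innerR x x := Real.sq_sqrt (innerR_self_nonneg x)

theorem mul_conj_self {n : ℕ} (x : A n) : mul x (conj x) = innerR x x • one n := by
  induction n with
  | zero => exact (_root_.mul_one (M := ℝ) _).symm
  | succ n ih =>
    have h := ih (conj (right x))
    rw [conj_conj, innerR_conj_conj] at h
    apply ext_pair
    · simp only [mul_succ, conj_succ, left_pair, right_pair, conj_neg, neg_mul, sub_neg_eq_add, ih,
        h, innerR_succ, left_smul, one, ← add_smul]
    · simp only [mul_succ, conj_succ, left_pair, right_pair, neg_mul, conj_conj, right_smul, one,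
        smul_zero, neg_add_cancel]

theorem conj_mul_self (x : A n) : mul (conj x) x = innerR x x • one n := by
  simpa only [conj_conj, innerR_conj_conj] using mul_conj_self (conj x)

theorem innerR_mul_left (a x y : A n) : innerR (mul a x) y = innerR x (mul (conj a) y) := by
  rw [innerR, innerR, re_mul_assoc, re_mul_comm, re_mul_assoc, conj_mul, conj_conj]

theorem innerR_mul_right (a x y : A n) : innerR (mul x a) y = innerR x (mul y (conj a)) := by
  rw [innerR, innerR, re_mul_assoc, conj_mul, conj_conj]

theorem mul_self_of_re {x : A n} (h : re x = 0) : mul x x = -(innerR x x • one n) := by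
  rw [← mul_conj_self, conj_eq_neg h, mul_neg, neg_neg]

theorem L_apply (a x : A n) : L a x = mul a x := rfl

theorem M_apply (a x : A n) : M a x = (1 / innerR a a) • mul (conj a) (mul a x) := by
  rw [← norm_sq]; rfl

theorem innerR_M (a x y : A n) : innerR (M a x) y = innerR x (M a y) := by
  simp only [M_apply, innerR_smul_left, innerR_smul_right, innerR_mul_left, conj_conj]

theorem mem_Eig {lam : ℝ} {a x : A n} : x ∈ Eig lam a ↔ M a x = lam • x :=
  Module.End.mem_eigenspace_iff

theorem mem_Eig_iff {lam : ℝ} {a x : A n} (ha : a ≠ 0) :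
    x ∈ Eig lam a ↔ mul (conj a) (mul a x) = (lam * innerR a a) • x := by
  rw [mem_Eig, M_apply, one_div, inv_smul_eq_iff₀ (innerR_self_ne_zero ha), smul_smul, mul_comm]

theorem mem_Eig_zero {a x : A n} (ha : a ≠ 0) : x ∈ Eig 0 a ↔ mul a x = 0 := by
  rw [mem_Eig_iff ha, MulZeroClass.zero_mul, zero_smul]
  refine ⟨fun h => innerR_self_eq_zero.1 ?_, fun h => by rw [h, mul_zero]⟩
  rw [innerR_mul_left, h, innerR_zero_right]

end Algebra

/-! ### Dimension and coordinate maps -/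

section Dimension

variable {n : ℕ}

/-- `A_{n+1}` as the product `A_n × A_n`. -/
noncomputable def prodEquiv (n : ℕ) : A (n + 1) ≃ₗ[ℝ] A n × A n := LinearEquiv.refl ℝ (A n × A n)

theorem finite_and_finrank (n : ℕ) : Module.Finite ℝ (A n) ∧ Module.finrank ℝ (A n) = 2 ^ n := by
  induction n with
  | zero => exact ⟨inferInstanceAs (Module.Finite ℝ ℝ), Module.finrank_self ℝ⟩
  | succ n ih =>
    obtain ⟨h1, h2⟩ := ih
    refine ⟨Module.Finite.equiv (prodEquiv n).symm, ?_⟩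
    rw [(prodEquiv n).finrank_eq, Module.finrank_prod, h2, pow_succ]
    ring

instance (n : ℕ) : Module.Finite ℝ (A n) := (finite_and_finrank n).1

theorem finrank_A (n : ℕ) : Module.finrank ℝ (A n) = 2 ^ n := (finite_and_finrank n).2

/-- The left component, as a linear map. -/
noncomputable def leftL (n : ℕ) : A (n + 1) →ₗ[ℝ] A n where
  toFun := left
  map_add' _ _ := rfl
  map_smul' _ _ := rfl

/-- The right component, as a linear map. -/
noncomputable def rightL (n : ℕ) : A (n + 1) →ₗ[ℝ] A n where
  toFun := right
  map_add' _ _ := rfl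
  map_smul' _ _ := rfl

/-- The real part, as a linear map. -/
noncomputable def reL (n : ℕ) : A n →ₗ[ℝ] ℝ where
  toFun := re
  map_add' := re_add
  map_smul' := re_smul

theorem reL_apply (x : A n) : reL n x = re x := rfl

end Dimension

/-! ### The complex structure given by `i = (0, 1)` -/

section ImaginaryUnit

variable {n : ℕ}

/-- The element `i_{n+1} = (0, 1)` of `A_{n+1}`. -/
noncomputable def iu (n : ℕ) : A (n + 1) := pair 0 (one n)

/-- Orthogonality to the span of `1` and `i_{n+1}`. -/
def Perp (x : A (n + 1)) : Prop := re (left x) = 0 ∧ re (right x) = 0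

theorem mul_pair (a b c d : A n) : mul (pair a b) (pair c d) =
    pair (mul a c - mul (conj d) b) (mul d a + mul b (conj c)) := rfl

theorem conj_pair (a b : A n) : conj (pair a b) = pair (conj a) (-b) := rfl

theorem iu_mul (x : A (n + 1)) : mul (iu n) x = pair (-conj (right x)) (conj (left x)) := by
  simp only [mul_succ, iu, left_pair, right_pair, zero_mul, mul_zero, one_mul, mul_one, zero_sub,
    zero_add]

theorem mul_iu (x : A (n + 1)) : mul x (iu n) = pair (-right x) (left x) := by
  simp only [mul_succ, iu, left_pair, right_pair, mul_zero, one_mul, conj_zero,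
    conj_one, zero_sub, add_zero]

theorem conj_iu : conj (iu n) = -iu n := by
  apply ext_pair <;> simp only [conj_succ, iu, left_pair, right_pair, left_neg, right_neg,
    conj_zero, neg_zero]

theorem innerR_iu_right (x : A (n + 1)) : innerR x (iu n) = re (right x) := by
  simp only [innerR_succ, iu, left_pair, right_pair, innerR_zero_right, innerR_one_right, zero_add]

theorem perp_iff_innerR {x : A (n + 1)} :
    Perp x ↔ innerR x (one (n + 1)) = 0 ∧ innerR x (iu n) = 0 := by
  rw [innerR_iu_right, innerR_one_right]; rfl

theorem Perp.re_eq_zero {x : A (n + 1)} (h : Perp x) : re x = 0 := h.1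

theorem Perp.smul {x : A (n + 1)} (h : Perp x) (r : ℝ) : Perp (r • x) := by
  constructor
  · rw [left_smul, re_smul, h.1, MulZeroClass.mul_zero]
  · rw [right_smul, re_smul, h.2, MulZeroClass.mul_zero]

theorem Perp.neg {x : A (n + 1)} (h : Perp x) : Perp (-x) := by
  rw [← neg_one_smul ℝ x]; exact h.smul _

theorem Perp.add {x y : A (n + 1)} (hx : Perp x) (hy : Perp y) : Perp (x + y) := by
  constructor
  · rw [left_add, re_add, hx.1, hy.1, add_zero]
  · rw [right_add, re_add, hx.2, hy.2, add_zero]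

theorem Perp.iu_mul {x : A (n + 1)} (h : Perp x) : Perp (mul (iu n) x) := by
  rw [CayleyDickson.iu_mul]
  constructor
  · rw [left_pair, re_neg, re_conj, h.2, neg_zero]
  · rw [right_pair, re_conj, h.1]

/-- The cancellation of `x` against `x^*` survives next to `i`, although alternativity fails in
general. Its conjugate puts `i` in every 1-eigenspace. -/
theorem mul_iu_mul_conj (x : A (n + 1)) :
    mul (mul (iu n) x) (conj x) = innerR x x • iu n := by
  rw [CayleyDickson.iu_mul, mul_succ, conj_succ]
  simp only [left_pair, right_pair, conj_neg, conj_conj, neg_mul, mul_neg, mul_conj_self,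
    conj_mul_self, innerR_succ]
  apply ext_pair
  · simp only [left_pair, iu, left_smul, smul_zero]; abel
  · simp only [right_pair, iu, right_smul, neg_neg]; module

theorem conj_mul_mul_iu (a : A (n + 1)) :
    mul (conj a) (mul a (iu n)) = innerR a a • iu n := by
  have h := congrArg conj (mul_iu_mul_conj (conj a))
  simp only [conj_mul, conj_conj, conj_iu, innerR_conj_conj, conj_smul, mul_neg, smul_neg,
    neg_inj] at h
  exact h

/-- Pair `ax = 0` with `x` and with `ix`, then move `x` across: the results are `‖x‖²` times the
coordinates of `a` along 1 and `i`. -/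
theorem perp_of_mul_eq_zero_left {a x : A (n + 1)} (h : mul a x = 0) (hx : x ≠ 0) : Perp a := by
  rw [perp_iff_innerR]
  have h1 : innerR (mul a x) x = 0 := by rw [h, innerR_zero_left]
  have h2 : innerR (mul a x) (mul (iu n) x) = 0 := by rw [h, innerR_zero_left]
  rw [innerR_mul_right, mul_conj_self, innerR_smul_right] at h1
  rw [innerR_mul_right, mul_iu_mul_conj, innerR_smul_right] at h2
  exact ⟨(mul_eq_zero.1 h1).resolve_left (innerR_self_ne_zero hx),
    (mul_eq_zero.1 h2).resolve_left (innerR_self_ne_zero hx)⟩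

theorem perp_of_mul_eq_zero_right {a x : A (n + 1)} (h : mul a x = 0) (ha : a ≠ 0) : Perp x := by
  rw [perp_iff_innerR]
  have h1 : innerR (mul a x) a = 0 := by rw [h, innerR_zero_left]
  have h2 : innerR (mul a x) (mul a (iu n)) = 0 := by rw [h, innerR_zero_left]
  rw [innerR_mul_left, conj_mul_self, innerR_smul_right] at h1
  rw [innerR_mul_left, conj_mul_mul_iu, innerR_smul_right] at h2
  exact ⟨(mul_eq_zero.1 h1).resolve_left (innerR_self_ne_zero ha),
    (mul_eq_zero.1 h2).resolve_left (innerR_self_ne_zero ha)⟩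

theorem Perp.conj_eq {x : A (n + 1)} (h : Perp x) : conj x = -x := conj_eq_neg h.1

theorem Perp.mul_iu {x : A (n + 1)} (h : Perp x) : mul x (iu n) = -mul (iu n) x := by
  rw [CayleyDickson.mul_iu, CayleyDickson.iu_mul, conj_eq_neg h.1, conj_eq_neg h.2]
  apply ext_pair <;> simp only [left_pair, right_pair, left_neg, right_neg, neg_neg]

theorem iu_mul_iu_mul (x : A (n + 1)) : mul (iu n) (mul (iu n) x) = -x := by
  rw [iu_mul x, iu_mul]
  apply ext_pair <;> simp only [left_pair, right_pair, left_neg, right_neg, conj_conj, conj_neg]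

/-- Away from `C`, multiplication is conjugate-linear in its second factor for the complex structure
`x ↦ ix`. -/
theorem mul_iu_mul_of_perp {p x : A (n + 1)} (hp : Perp p) (hx : Perp x) :
    mul p (mul (iu n) x) = -mul (iu n) (mul p x) := by
  rw [iu_mul x, iu_mul (mul p x), mul_succ, mul_succ]
  simp only [left_pair, right_pair, conj_neg, conj_add, conj_sub, conj_mul,
    conj_eq_neg hp.1, conj_eq_neg hp.2, conj_eq_neg hx.1, conj_eq_neg hx.2, mul_neg, neg_mul,
    neg_neg]
  apply ext_pair <;> simp only [left_pair, right_pair, left_neg, right_neg] <;> abel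

theorem iu_mul_mul_of_perp {p x : A (n + 1)} (hp : Perp p) (hx : Perp x) :
    mul (mul (iu n) p) x = mul (mul p x) (iu n) := by
  rw [iu_mul p, mul_iu (mul p x), mul_succ, mul_succ]
  simp only [left_pair, right_pair,
    conj_eq_neg hp.1, conj_eq_neg hp.2, conj_eq_neg hx.1, conj_eq_neg hx.2, mul_neg, neg_mul,
    neg_neg]
  apply ext_pair <;> simp only [left_pair, right_pair] <;> abel

end ImaginaryUnit

/-! ### Products of the elements `(p, ±ip)` -/

section Bracket

variable {n : ℕ}

/-- The element `(p, ε i p)` of `A_{n+2}`, where `i = i_{n+1}`. -/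
noncomputable def br (ε : ℝ) (p : A (n + 1)) : A (n + 2) := pair p (ε • mul (iu n) p)

theorem br_smul (ε r : ℝ) (p : A (n + 1)) : br ε (r • p) = r • br ε p := by
  apply ext_pair
  · rfl
  · simp only [br, right_pair, right_smul, mul_smul, smul_comm r ε]

theorem br_add (ε : ℝ) (p q : A (n + 1)) : br ε (p + q) = br ε p + br ε q := by
  apply ext_pair
  · rfl
  · simp only [br, right_pair, right_add, mul_add, smul_add]

theorem br_zero (ε : ℝ) : br ε (0 : A (n + 1)) = 0 := by
  apply ext_pair
  · rfl
  · simp only [br, right_pair, right_zero, mul_zero, smul_zero]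

theorem br_eq_zero {ε : ℝ} {p : A (n + 1)} : br ε p = 0 ↔ p = 0 :=
  ⟨fun h => congrArg left h, fun h => h ▸ br_zero ε⟩

theorem perp_br (ε : ℝ) {p : A (n + 1)} (hp : Perp p) : Perp (br ε p) :=
  ⟨hp.re_eq_zero, (hp.iu_mul.smul ε).re_eq_zero⟩

theorem innerR_br_self {ε : ℝ} (hε : ε * ε = 1) (p : A (n + 1)) :
    innerR (br ε p) (br ε p) = 2 * innerR p p := by
  rw [innerR_succ, br, left_pair, right_pair, innerR_smul_left, innerR_smul_right, innerR_mul_left,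
    conj_iu, neg_mul, iu_mul_iu_mul, neg_neg]
  linear_combination innerR p p * hε

theorem br_mul_br (ε δ : ℝ) {p x : A (n + 1)} (hp : Perp p) (hx : Perp x) :
    mul (br ε p) (br δ x) =
      pair (mul p x - (ε * δ) • mul (iu n) (mul (conj (mul p x)) (iu n)))
        (mul (δ • conj (mul p x) - ε • mul p x) (iu n)) := by
  have hxp : conj (mul p x) = mul x p := by
    rw [conj_mul, hp.conj_eq, hx.conj_eq, neg_mul, mul_neg, neg_neg]
  rw [hxp, mul_succ, br, br]
  simp only [left_pair, right_pair, conj_smul, mul_smul, smul_mul, hx.iu_mul.conj_eq, hx.conj_eq,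
    neg_mul, mul_neg, smul_neg, iu_mul_mul_of_perp hp hx, iu_mul_mul_of_perp hx hp, sub_mul,
    mul_iu_mul_of_perp hx.iu_mul hp]
  apply ext_pair
  · simp only [left_pair, smul_smul, neg_neg]
  · simp only [right_pair]; abel

theorem br_mul_br_self {ε : ℝ} (hε : ε * ε = 1) {p x : A (n + 1)} (hp : Perp p) (hx : Perp x) :
    mul (br ε p) (br ε x) =
      pair (pair ((2 : ℝ) • left (mul p x)) (right (mul p x) - conj (right (mul p x))))
        (ε • pair ((2 : ℝ) • right (mul p x)) (conj (left (mul p x)) - left (mul p x))) := by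
  rw [br_mul_br ε ε hp hx, hε, one_smul, ← smul_sub, smul_mul]
  generalize mul p x = z
  congr 1
  · rw [iu_mul, mul_iu, conj_succ]
    simp only [left_pair, right_pair]
    apply ext_pair
    · simp only [left_pair, left_sub, conj_conj, two_smul]; abel
    · simp only [right_pair, right_sub, neg_neg]
  · rw [mul_iu, conj_succ]
    congr 2
    simp only [right_pair, right_sub, two_smul]; abel

/-- With equal signs the two terms in each component agree off `C`, hence the factor 2; this is the
source of the powers of 2. -/
theorem br_mul_br_of_perp {ε : ℝ} (hε : ε * ε = 1) {p x : A (n + 1)} (hp : Perp p) (hx : Perp x)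
    (h : Perp (mul p x)) : mul (br ε p) (br ε x) = br ε ((2 : ℝ) • mul p x) := by
  rw [br_mul_br_self hε hp hx, conj_eq_neg h.1, conj_eq_neg h.2, br, mul_smul, iu_mul,
    conj_eq_neg h.1, conj_eq_neg h.2]
  congr 1
  · apply ext_pair <;> simp only [left_pair, right_pair, left_smul, right_smul]
    module
  · congr 1
    apply ext_pair <;> simp only [left_pair, right_pair, left_smul, right_smul] <;> module

/-- With opposite signs the terms cancel off `C`, so only the `C`-part of `px` survives, as a
combination of `(i, 0)` and `(0, i)`. -/
theorem br_mul_br_neg {ε : ℝ} (hε : ε * ε = 1) {p x : A (n + 1)} (hp : Perp p) (hx : Perp x) :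
    mul (br ε p) (br (-ε) x) =
      pair ((2 * re (right (mul p x))) • iu n) ((-ε * (2 * re (left (mul p x)))) • iu n) := by
  have h1 : ε * -ε = -1 := by linarith
  rw [br_mul_br ε (-ε) hp hx, h1, neg_smul, one_smul, sub_neg_eq_add, neg_smul, ← neg_add',
    ← smul_add, ← neg_smul, smul_mul,
    SemigroupAction.mul_smul (-ε)]
  generalize mul p x = z
  congr 1
  · rw [iu_mul, mul_iu, conj_succ]
    simp only [left_pair, right_pair]
    apply ext_pair
    · simp only [left_pair, left_add, conj_conj, iu, left_smul, smul_zero]; abel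
    · simp only [right_pair, right_add, neg_neg, iu, right_smul, add_conj]
  · rw [mul_iu, conj_succ]
    refine congrArg (-ε • ·) (ext_pair ?_ ?_)
    · simp only [left_pair, right_pair, right_add, iu, left_smul, smul_zero]; abel
    · simp only [left_pair, right_pair, left_add, iu, right_smul, ← add_conj]; abel

end Bracket

/-- The counting device for all kernel estimates: imposing `T = 0` costs at most `dim W`, and what
remains embeds in `S` through `F`. Taking `W = Fin 0 → ℝ` imposes nothing. -/
theorem finrank_le_add_of_injOn {V W X : Type*} [AddCommGroup V] [Module ℝ V]
    [AddCommGroup W] [Module ℝ W] [AddCommGroup X] [Module ℝ X] [Module.Finite ℝ V]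
    [Module.Finite ℝ W] [Module.Finite ℝ X] (K : Submodule ℝ V) (T : V →ₗ[ℝ] W) (F : V →ₗ[ℝ] X)
    (S : Submodule ℝ X) (hS : ∀ w ∈ K, T w = 0 → F w ∈ S)
    (h0 : ∀ w ∈ K, T w = 0 → F w = 0 → w = 0) :
    Module.finrank ℝ K ≤ Module.finrank ℝ W + Module.finrank ℝ S := by
  rw [← (T.domRestrict K).finrank_range_add_finrank_ker]
  refine Nat.add_le_add (Submodule.finrank_le _) ?_
  have hmem : ∀ w : LinearMap.ker (T.domRestrict K), T w.1.1 = 0 := fun w => w.2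
  refine LinearMap.finrank_le_finrank_of_injective
    (f := ((F ∘ₗ K.subtype) ∘ₗ (LinearMap.ker (T.domRestrict K)).subtype).codRestrict S
      fun w => hS _ w.1.2 (hmem w)) ?_
  rw [← LinearMap.ker_eq_bot, LinearMap.ker_eq_bot']
  intro w hw
  exact Subtype.ext (Subtype.ext (h0 _ w.1.2 (hmem w) (congrArg Subtype.val hw)))

theorem finrank_submodule_prod_le {V W : Type*} [AddCommGroup V] [Module ℝ V]
    [AddCommGroup W] [Module ℝ W] [Module.Finite ℝ V] [Module.Finite ℝ W]
    (S : Submodule ℝ V) (T : Submodule ℝ W) :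
    Module.finrank ℝ (S.prod T) ≤ Module.finrank ℝ S + Module.finrank ℝ T := by
  rw [← Module.finrank_prod]
  refine LinearMap.finrank_le_finrank_of_injective
    (f := ((LinearMap.fst ℝ V W).restrict (p := S.prod T) (q := S) fun _ h => h.1).prod
      ((LinearMap.snd ℝ V W).restrict (p := S.prod T) (q := T) fun _ h => h.2)) ?_
  intro x y h
  exact Subtype.ext (Prod.ext (congrArg (fun t => t.1.1) h) (congrArg (fun t => t.2.1) h))

/-! ### Orthogonality of eigenspaces and the 1-eigenspace -/

section Eigenspaces

variable {n : ℕ}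

theorem innerR_eq_zero_of_mem_Eig {a x y : A n} {lam mu : ℝ} (h : lam ≠ mu)
    (hx : x ∈ Eig lam a) (hy : y ∈ Eig mu a) : innerR x y = 0 := by
  have h1 := innerR_M a x y
  rw [mem_Eig.1 hx, mem_Eig.1 hy, innerR_smul_left, innerR_smul_right, ← sub_eq_zero,
    ← _root_.sub_mul] at h1
  exact (mul_eq_zero.1 h1).resolve_left (sub_ne_zero.2 h)

theorem mul_mem_Eig {a x : A n} {lam : ℝ} (ha : a ≠ 0) (hc : conj a = -a) (hx : x ∈ Eig lam a) :
    mul a x ∈ Eig lam a := by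
  rw [mem_Eig_iff ha, hc, neg_mul] at hx ⊢
  rw [← mul_neg, hx, mul_smul]

theorem one_mem_Eig_one {a : A n} (ha : a ≠ 0) : one n ∈ Eig 1 a := by
  rw [mem_Eig_iff ha, mul_one, conj_mul_self, _root_.one_mul]

theorem iu_mem_Eig_one {a : A (n + 1)} (ha : a ≠ 0) : iu n ∈ Eig 1 a := by
  rw [mem_Eig_iff ha, conj_mul_mul_iu, _root_.one_mul]

theorem perp_of_mem_Eig {a x : A (n + 1)} {lam : ℝ} (ha : a ≠ 0) (h : lam ≠ 1)
    (hx : x ∈ Eig lam a) : Perp x := by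
  rw [perp_iff_innerR]
  exact ⟨innerR_eq_zero_of_mem_Eig h hx (one_mem_Eig_one ha),
    innerR_eq_zero_of_mem_Eig h hx (iu_mem_Eig_one ha)⟩

theorem mul_self_of_perp {p : A (n + 1)} (hp : Perp p) : mul p p = -(innerR p p • one (n + 1)) :=
  mul_self_of_re hp.re_eq_zero

theorem mul_iu_mul_self {p : A (n + 1)} (hp : Perp p) :
    mul p (mul (iu n) p) = innerR p p • iu n := by
  rw [mul_iu_mul_of_perp hp hp, mul_self_of_perp hp, mul_neg, neg_neg, mul_smul, mul_one]

theorem br_mul_iu_zero (ε : ℝ) {p : A (n + 1)} (hp : Perp p) :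
    mul (br ε p) (pair (iu n) 0) = -br (-ε) (mul (iu n) p) := by
  apply ext_pair
  · simp only [mul_pair, br, left_pair, conj_zero, zero_mul, sub_zero, left_neg,
      hp.mul_iu]
  · simp only [mul_pair, br, right_pair, zero_mul, right_neg, zero_add, conj_iu,
      mul_neg, smul_mul, hp.iu_mul.mul_iu, iu_mul_iu_mul]
    module

theorem br_mul_zero_iu (ε : ℝ) {p : A (n + 1)} (hε : ε * ε = 1) :
    mul (br ε p) (pair 0 (iu n)) = -ε • br (-ε) p := by
  apply ext_pair
  · simp only [mul_pair, br, left_pair, mul_zero, conj_iu, neg_mul, left_smul, zero_sub,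
      mul_smul, iu_mul_iu_mul]
    module
  · simp only [mul_pair, br, right_pair, conj_zero, mul_zero, add_zero, right_smul,
      smul_smul, neg_mul_neg, hε, one_smul]

theorem br_ne_zero {ε : ℝ} {p : A (n + 1)} (h : p ≠ 0) : br ε p ≠ 0 := fun h' => h (br_eq_zero.1 h')

theorem mem_Eig_br {ε lam : ℝ} (hε : ε * ε = 1) {p : A (n + 1)} (h0 : p ≠ 0) (hp : Perp p)
    {w : A (n + 2)} : w ∈ Eig lam (br ε p) ↔
      mul (br ε p) (mul (br ε p) w) = (-lam * (2 * innerR p p)) • w := by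
  rw [mem_Eig_iff (br_ne_zero h0), (perp_br ε hp).conj_eq, innerR_br_self hε, neg_mul, neg_eq_iff_eq_neg,
    ← neg_smul, _root_.neg_mul]

theorem iu_zero_mem_Eig_one {ε : ℝ} (hε : ε * ε = 1) {p : A (n + 1)} (h0 : p ≠ 0) (hp : Perp p) :
    pair (iu n) 0 ∈ Eig 1 (br ε p) := by
  rw [mem_Eig_br hε h0 hp, br_mul_iu_zero ε hp, mul_neg, br_mul_br_neg hε hp hp.iu_mul,
    mul_iu_mul_self hp]
  apply ext_pair
  · simp only [left_neg, left_smul, right_smul, left_pair, iu, right_pair, re_smul, re_one]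
    module
  · simp only [right_neg, left_smul, right_smul, left_pair, iu, right_pair, re_smul, re_zero]
    module

theorem zero_iu_mem_Eig_one {ε : ℝ} (hε : ε * ε = 1) {p : A (n + 1)} (h0 : p ≠ 0) (hp : Perp p) :
    pair 0 (iu n) ∈ Eig 1 (br ε p) := by
  rw [mem_Eig_br hε h0 hp, br_mul_zero_iu ε hε, mul_smul, br_mul_br_neg hε hp hp,
    mul_self_of_perp hp]
  apply ext_pair
  · simp only [left_smul, right_smul, left_pair, one, right_pair, right_neg, re_neg, re_smul,
      re_zero]
    module
  · simp only [left_smul, right_smul, left_neg, left_pair, one, right_pair, re_neg, re_smul, re_one,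
      smul_smul]
    congr 1
    linear_combination (-2 * innerR p p) * hε

end Eigenspaces

/-! ### Upper bounds for annihilators -/

section Components

variable {n : ℕ}

/-- The component `p` of `br ε p + br (-ε) q`. -/
noncomputable def cmp (ε : ℝ) : A (n + 2) →ₗ[ℝ] A (n + 1) :=
  (1 / 2 : ℝ) • (leftL (n + 1) - ε • (L (iu n) ∘ₗ rightL (n + 1)))

theorem cmp_apply (ε : ℝ) (w : A (n + 2)) :
    cmp ε w = (1 / 2 : ℝ) • (left w - ε • mul (iu n) (right w)) := rfl

theorem br_cmp_add_br_cmp {ε : ℝ} (hε : ε * ε = 1) (w : A (n + 2)) :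
    br ε (cmp ε w) + br (-ε) (cmp (-ε) w) = w := by
  apply ext_pair
  · simp only [left_add, br, left_pair, cmp_apply]; module
  · simp only [right_add, br, right_pair, cmp_apply, mul_smul, mul_sub, iu_mul_iu_mul]
    have : right w = (ε * ε) • right w := by rw [hε, one_smul]
    conv_rhs => rw [this]
    module

theorem perp_cmp (ε : ℝ) {w : A (n + 2)} (h1 : Perp (left w)) (h2 : Perp (right w)) :
    Perp (cmp ε w) := by
  rw [cmp_apply, sub_eq_add_neg]
  exact (h1.add (h2.iu_mul.smul ε).neg).smul _

/-- The map `x ↦ (Re x, ⟨x, i⟩)`. -/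
noncomputable def cL (n : ℕ) : A (n + 1) →ₗ[ℝ] ℝ × ℝ :=
  (reL n ∘ₗ leftL n).prod (reL n ∘ₗ rightL n)

theorem cL_eq_zero {x : A (n + 1)} : cL n x = 0 ↔ Perp x := Prod.ext_iff

theorem cL_apply (x : A (n + 1)) : cL n x = (re (left x), re (right x)) := rfl

theorem eq_zero_of_add_smul_iu {x : A (n + 1)} (hx : Perp x) {r : ℝ} (h : x + r • iu n = 0) :
    x = 0 := by
  have h1 := congrArg (fun t => re (right t)) h
  simp only [right_add, right_smul, iu, right_pair, re_add, re_smul, re_one, hx.2, right_zero,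
    re_zero, _root_.mul_one, zero_add] at h1
  rwa [h1, zero_smul, add_zero] at h

/-- For `w = br 1 x + br (-1) y` in the kernel, the mixed products lie along `(i, 0)` and `(0, i)`.
Once `px` and `qy` are orthogonal to `C`, both must vanish separately. -/
theorem finrank_ker_br_add_br {p q : A (n + 1)} (hp : Perp p) (hq : Perp q) (h : p ≠ 0 ∨ q ≠ 0) :
    Module.finrank ℝ (LinearMap.ker (L (br 1 p + br (-1) q))) ≤
      6 + Module.finrank ℝ (LinearMap.ker (L p)) + Module.finrank ℝ (LinearMap.ker (L q)) := by
  have hne : br 1 p + br (-1) q ≠ 0 := by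
    intro h0
    have h1 : p + q = 0 := congrArg left h0
    have h2 : (1 : ℝ) • mul (iu n) p + (-1 : ℝ) • mul (iu n) q = 0 := congrArg right h0
    have h3 := congrArg (mul (iu n)) h2
    simp only [mul_add, mul_smul, iu_mul_iu_mul, mul_zero] at h3
    have h4 : p = 0 := by
      have : p = (1 / 2 : ℝ) • ((p + q) - ((1 : ℝ) • -p + (-1 : ℝ) • -q)) := by module
      rw [this, h1, h3, sub_zero, smul_zero]
    rw [h4, zero_add] at h1
    exact h.elim (· h4) (· h1)
  -- The six conditions: two remove the `i`-coordinates of the components of `w` (their real parts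
  -- vanish already), four remove the `C`-parts of `px` and `qy`.
  have key := finrank_le_add_of_injOn (LinearMap.ker (L (br 1 p + br (-1) q)))
    (((reL n ∘ₗ rightL n ∘ₗ leftL (n + 1)).prod (reL n ∘ₗ rightL n ∘ₗ rightL (n + 1))).prod
      ((cL n ∘ₗ L p ∘ₗ cmp 1).prod (cL n ∘ₗ L q ∘ₗ cmp (-1))))
    ((cmp 1).prod (cmp (-1)))
    ((LinearMap.ker (L p)).prod (LinearMap.ker (L q))) ?_ ?_
  · have := finrank_submodule_prod_le (LinearMap.ker (L p)) (LinearMap.ker (L q))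
    simp only [Module.finrank_prod, Module.finrank_self] at key
    omega
  · intro w hw hT
    have hw' : mul (br 1 p + br (-1) q) w = 0 := hw
    have hperp := perp_of_mul_eq_zero_right hw' hne
    simp only [LinearMap.prod_apply, Function.prod_apply, Prod.mk_eq_zero, LinearMap.comp_apply,
      cL_eq_zero] at hT
    obtain ⟨⟨h1, h2⟩, h3, h4⟩ := hT
    have hx := perp_cmp 1 ⟨hperp.1, h1⟩ ⟨hperp.2, h2⟩
    have hy := perp_cmp (-1) ⟨hperp.1, h1⟩ ⟨hperp.2, h2⟩
    rw [← br_cmp_add_br_cmp (_root_.one_mul 1) w] at hw'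
    simp only [LinearMap.prod_apply, Function.prod_apply, Submodule.mem_prod, LinearMap.mem_ker]
    rw [L_apply] at h3 h4 ⊢
    rw [L_apply]
    generalize cmp 1 w = x at *
    generalize cmp (-1) w = y at *
    have e1 := br_mul_br_neg (_root_.one_mul 1) hp hy
    have e2 := br_mul_br_neg (neg_mul_neg 1 1 |>.trans (_root_.one_mul 1)) hq hx
    rw [neg_neg] at e2
    rw [add_mul, mul_add, mul_add, br_mul_br_of_perp (_root_.one_mul 1) hp hx h3,
      br_mul_br_of_perp (neg_mul_neg 1 1 |>.trans (_root_.one_mul 1)) hq hy h4, e1, e2] at hw'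
    generalize mul p x = z at *
    generalize mul q y = z' at *
    have hl := congrArg left hw'
    have hr := congrArg right hw'
    have hl' : (2 : ℝ) • (z + z') + (2 * (re (right (mul p y)) + re (right (mul q x)))) • iu n = 0 := by
      refine Eq.trans ?_ hl; simp only [left_add, br, left_pair]; module
    have hr' : mul (iu n) ((2 : ℝ) • (z - z')) +
        (2 * (re (left (mul q x)) - re (left (mul p y)))) • iu n = 0 := by
      refine Eq.trans ?_ hr; simp only [right_add, br, right_pair, mul_smul, mul_sub]; module
    have e3 := eq_zero_of_add_smul_iu ((h3.add h4).smul 2) hl'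
    have e4 := eq_zero_of_add_smul_iu (((h3.add h4.neg).smul 2).iu_mul) (by rwa [← sub_eq_add_neg])
    have e5 : z - z' = 0 := by
      have := congrArg (mul (iu n)) e4
      rw [iu_mul_iu_mul, mul_zero, neg_eq_zero, ← sub_eq_add_neg] at this
      exact (smul_eq_zero.1 this).resolve_left two_ne_zero
    have e6 : z + z' = 0 := (smul_eq_zero.1 e3).resolve_left two_ne_zero
    constructor
    · rw [show z = (1 / 2 : ℝ) • ((z + z') + (z - z')) by module, e5, e6, add_zero, smul_zero]
    · rw [show z' = (1 / 2 : ℝ) • ((z + z') - (z - z')) by module, e5, e6, sub_zero, smul_zero]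
  · intro w _ _ h0
    simp only [LinearMap.prod_apply, Function.prod_apply, Prod.mk_eq_zero] at h0
    rw [← br_cmp_add_br_cmp (_root_.one_mul 1) w, h0.1, h0.2, br_zero, br_zero, add_zero]

/-- The elements `y` orthogonal to `1`, `i` for which `p y` is orthogonal to `1`, `i` too; the
orthogonal complement of the span of `1`, `i`, `p`, `i p` when `p` is orthogonal to `1`, `i`. -/
noncomputable def quatPerp (p : A (n + 1)) : Submodule ℝ (A (n + 1)) :=
  LinearMap.ker ((cL n).prod (cL n ∘ₗ L p))

theorem mem_quatPerp {p y : A (n + 1)} : y ∈ quatPerp p ↔ Perp y ∧ Perp (mul p y) := by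
  rw [quatPerp, LinearMap.mem_ker, ← cL_eq_zero, ← cL_eq_zero]
  exact Prod.ext_iff

theorem finrank_quatPerp {p : A (n + 1)} (h0 : p ≠ 0) (hp : Perp p) :
    Module.finrank ℝ (quatPerp p) + 4 = 2 ^ (n + 1) := by
  have hsurj : Function.Surjective ((cL n).prod (cL n ∘ₗ L p)) := by
    rintro ⟨⟨r, s⟩, t, u⟩
    have hN := innerR_self_ne_zero h0
    have h1 : re (left (one (n + 1))) = 1 := re_one
    have h2 : re (right (one (n + 1))) = 0 := re_zero
    have h3 : re (left (iu n)) = 0 := re_zero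
    have h4 : re (right (iu n)) = 1 := re_one
    -- The elements `p` and `ip` are orthogonal to `C`, while `L_p` sends them to `-‖p‖²` and `‖p‖²
    -- i`; on 1 and `i` the roles are reversed.
    refine ⟨r • one (n + 1) + s • iu n + (-t / innerR p p) • p +
      (u / innerR p p) • mul (iu n) p, ?_⟩
    simp only [LinearMap.prod_apply, Function.prod_apply, LinearMap.comp_apply, cL_apply, L_apply,
      mul_add, mul_smul, mul_one, hp.mul_iu, mul_self_of_perp hp, mul_iu_mul_self hp, left_add,
      right_add, left_smul, right_smul, left_neg, right_neg, re_add, re_smul, re_neg, h1, h2, h3,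
      h4, hp.1, hp.2, hp.iu_mul.1, hp.iu_mul.2]
    refine Prod.ext (Prod.ext ?_ ?_) (Prod.ext ?_ ?_) <;> simp <;> field_simp
  have h := ((cL n).prod (cL n ∘ₗ L p)).finrank_range_add_finrank_ker
  rw [LinearMap.range_eq_top.2 hsurj, finrank_top, finrank_A] at h
  simp only [Module.finrank_prod, Module.finrank_self] at h
  rw [quatPerp]
  omega

/-- A kernel element `br ε x + br (-ε) y` satisfies `px = 0`, whereas `y` need only be orthogonal to
`C` with `py ⟂ C`, a space of codimension 4. -/
theorem finrank_ker_br {ε : ℝ} (hε : ε * ε = 1) {p : A (n + 1)} (h0 : p ≠ 0) (hp : Perp p) :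
    Module.finrank ℝ (LinearMap.ker (L (br ε p))) + 4 ≤
      Module.finrank ℝ (LinearMap.ker (L p)) + 2 ^ (n + 1) := by
  have hε' : -ε * -ε = 1 := by rw [neg_mul_neg, hε]
  have key := finrank_le_add_of_injOn (LinearMap.ker (L (br ε p))) (0 : A (n + 2) →ₗ[ℝ] Fin 0 → ℝ)
    ((cmp ε).prod (cmp (-ε))) ((LinearMap.ker (L p)).prod (quatPerp p)) ?_ ?_
  · have h1 := finrank_submodule_prod_le (LinearMap.ker (L p)) (quatPerp p)
    have h2 := finrank_quatPerp h0 hp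
    rw [Module.finrank_fin_fun] at key
    omega
  · intro w hw _
    have hw' : mul (br ε p) w = 0 := hw
    have hE := (mem_Eig_zero (br_ne_zero h0)).2 hw'
    -- The kernel is orthogonal to `Eig_1`, which contains all of `C × C`; hence both components of
    -- `w` are orthogonal to `C`.
    have hperp := perp_of_mem_Eig (br_ne_zero h0) zero_ne_one hE
    have h1 := innerR_eq_zero_of_mem_Eig zero_ne_one hE (iu_zero_mem_Eig_one hε h0 hp)
    have h2 := innerR_eq_zero_of_mem_Eig zero_ne_one hE (zero_iu_mem_Eig_one hε h0 hp)
    rw [innerR_succ, left_pair, right_pair, innerR_zero_right, innerR_iu_right, add_zero] at h1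
    rw [innerR_succ, left_pair, right_pair, innerR_zero_right, innerR_iu_right, zero_add] at h2
    have hx := perp_cmp ε ⟨hperp.1, h1⟩ ⟨hperp.2, h2⟩
    have hy := perp_cmp (-ε) ⟨hperp.1, h1⟩ ⟨hperp.2, h2⟩
    simp only [LinearMap.prod_apply, Function.prod_apply, Submodule.mem_prod, LinearMap.mem_ker,
      mem_quatPerp, L_apply]
    rw [← br_cmp_add_br_cmp hε w, mul_add, br_mul_br_self hε hp hx, br_mul_br_neg hε hp hy] at hw'
    generalize mul p (cmp ε w) = z at *
    generalize mul p (cmp (-ε) w) = z' at *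
    have hε0 : ε ≠ 0 := fun h => by simp [h] at hε
    -- The outer quarters contain only `z`. In the other two, `z` contributes a difference with its
    -- conjugate, so taking real parts isolates `z'`.
    have ell := congrArg (fun t => left (left t)) hw'
    have elr := congrArg (fun t => re (right (left t))) hw'
    have erl := congrArg (fun t => left (right t)) hw'
    have err := congrArg (fun t => re (right (right t))) hw'
    simp only [left_add, right_add, left_pair, right_pair, left_smul, right_smul, iu, re_add, re_sub,
      re_smul, re_conj, smul_zero, add_zero, left_zero, right_zero, re_one, re_zero, sub_self,
      zero_add, _root_.mul_one, MulZeroClass.mul_zero] at ell elr erl err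
    refine ⟨ext_pair ((smul_eq_zero.1 ell).resolve_left two_ne_zero) ?_, hy, ?_, ?_⟩
    · exact (smul_eq_zero.1 ((smul_eq_zero.1 erl).resolve_left hε0)).resolve_left two_ne_zero
    · simpa [hε0] using err
    · simpa using elr
  · intro w _ _ h0
    simp only [LinearMap.prod_apply, Function.prod_apply, Prod.mk_eq_zero] at h0
    rw [← br_cmp_add_br_cmp hε w, h0.1, h0.2, br_zero, br_zero, add_zero]

end Components

/-! ### The non-orthogonal case and lower bounds for eigenspaces -/

section LowerBounds

variable {n : ℕ}

theorem Perp.of_conj {x : A (n + 1)} (h : Perp (conj x)) : Perp x := by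
  obtain ⟨h1, h2⟩ := h
  rw [conj_succ, left_pair, re_conj] at h1
  rw [conj_succ, right_pair, re_neg, neg_eq_zero] at h2
  exact ⟨h1, h2⟩

theorem perp_of_mul_eq_zero_left' {a x : A (n + 1)} (h : mul a x = 0) (ha : a ≠ 0) : Perp x := by
  have h' := congrArg conj h
  rw [conj_mul, conj_zero] at h'
  refine (perp_of_mul_eq_zero_left h' fun h0 => ha ?_).of_conj
  rw [← conj_conj a, h0, conj_zero]

theorem finrank_ker_reL (n : ℕ) : Module.finrank ℝ (LinearMap.ker (reL n)) + 1 = 2 ^ n := by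
  have h := (reL n).finrank_range_add_finrank_ker
  rw [LinearMap.range_eq_top.2 fun r => ⟨r • one n, by
    rw [reL_apply, re_smul, re_one, _root_.mul_one]⟩, finrank_top, Module.finrank_self,
    finrank_A] at h
  omega

/-- If `(0, y)` with `y ≠ 0` is annihilated, then `y` annihilates `left a` and `y^*` annihilates
`right a`, so both are orthogonal to `C`. Otherwise a kernel element is determined by its left
component, which is imaginary. -/
theorem finrank_ker_of_not_perp {a : A (n + 2)} (ha : a ≠ 0)
    (h : ¬(Perp (left a) ∧ Perp (right a))) :
    Module.finrank ℝ (LinearMap.ker (L a)) + 1 ≤ 2 ^ (n + 1) := by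
  have key := finrank_le_add_of_injOn (LinearMap.ker (L a)) (0 : A (n + 2) →ₗ[ℝ] Fin 0 → ℝ)
    (leftL (n + 1)) (LinearMap.ker (reL (n + 1))) ?_ ?_
  · have := finrank_ker_reL (n + 1)
    rw [Module.finrank_fin_fun] at key
    omega
  · intro w hw _
    exact (perp_of_mul_eq_zero_right (show mul a w = 0 from hw) ha).1
  · intro w hw _ h0
    have hw' : mul a w = 0 := hw
    have h0' : left w = 0 := h0
    refine ext_pair h0' ?_
    by_contra hr
    rw [mul_succ, h0', mul_zero, conj_zero, mul_zero, zero_sub, add_zero] at hw'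
    have h1 : mul (conj (right w)) (right a) = 0 := neg_eq_zero.1 (congrArg left hw')
    have h2 : mul (right w) (left a) = 0 := congrArg right hw'
    refine h ⟨perp_of_mul_eq_zero_left' h2 hr, perp_of_mul_eq_zero_left' h1 fun h3 => hr ?_⟩
    rw [← conj_conj (right w), h3, conj_zero]; rfl

theorem Eig_zero_eq_ker {a : A n} (ha : a ≠ 0) : Eig 0 a = LinearMap.ker (L a) := by
  ext x
  rw [mem_Eig_zero ha, LinearMap.mem_ker, L_apply]

theorem Eig_le_quatPerp {p : A (n + 1)} (h0 : p ≠ 0) (hp : Perp p) {lam : ℝ} (h : lam ≠ 1) :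
    Eig lam p ≤ quatPerp p := fun _ hx =>
  mem_quatPerp.2 ⟨perp_of_mem_Eig h0 h hx, perp_of_mem_Eig h0 h (mul_mem_Eig h0 hp.conj_eq hx)⟩

theorem finrank_Eig_le_add_four (lam : ℝ) (p : A (n + 1)) :
    Module.finrank ℝ (Eig lam p) ≤
      4 + Module.finrank ℝ (Eig lam p ⊓ quatPerp p : Submodule ℝ (A (n + 1))) := by
  have key := finrank_le_add_of_injOn (Eig lam p) ((cL n).prod (cL n ∘ₗ L p)) LinearMap.id
    (Eig lam p ⊓ quatPerp p) (fun w hw h => ⟨hw, h⟩) (fun w _ _ h => h)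
  simpa [Module.finrank_prod] using key

/-- `br ε` as a linear map. -/
noncomputable def brL (ε : ℝ) : A (n + 1) →ₗ[ℝ] A (n + 2) where
  toFun := br ε
  map_add' := br_add ε
  map_smul' := br_smul ε

theorem brL_apply (ε : ℝ) (p : A (n + 1)) : brL ε p = br ε p := rfl

/-- Applying `L_{br ε p}` twice yields a factor 4 and the squared norm of `br ε p` contributes 2, so
the eigenvalue doubles. -/
theorem finrank_Eig_inf_quatPerp_le {ε : ℝ} (hε : ε * ε = 1) {p : A (n + 1)} (h0 : p ≠ 0)
    (hp : Perp p) (lam : ℝ) :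
    Module.finrank ℝ (Eig lam p ⊓ quatPerp p : Submodule ℝ (A (n + 1))) ≤
      Module.finrank ℝ (Eig (2 * lam) (br ε p)) := by
  have key := finrank_le_add_of_injOn (Eig lam p ⊓ quatPerp p)
    (0 : A (n + 1) →ₗ[ℝ] Fin 0 → ℝ) (brL ε) (Eig (2 * lam) (br ε p)) ?_ ?_
  · simpa using key
  · rintro x ⟨hx, hx'⟩ _
    obtain ⟨h1, h2⟩ := mem_quatPerp.1 hx'
    rw [SetLike.mem_coe, mem_Eig_iff h0, hp.conj_eq, neg_mul, neg_eq_iff_eq_neg] at hx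
    rw [brL_apply, mem_Eig_br hε h0 hp, br_mul_br_of_perp hε hp h1 h2, br_smul, mul_smul,
      br_mul_br_of_perp hε hp h2 (hx ▸ (h1.smul _).neg), hx, ← br_smul, ← br_smul]
    congr 1
    module
  · intro x _ _ h
    exact br_eq_zero.1 h

/-- The parametrization of `C × C`, where `C` is the span of `1` and `i`. -/
noncomputable def quatL (n : ℕ) : (Fin 4 → ℝ) →ₗ[ℝ] A (n + 2) where
  toFun v := pair (v 0 • one (n + 1) + v 1 • iu n) (v 2 • one (n + 1) + v 3 • iu n)
  map_add' v w := by
    apply ext_pair <;> simp only [left_add, right_add, left_pair, right_pair, Pi.add_apply] <;>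
      module
  map_smul' r v := by
    apply ext_pair <;> simp only [left_smul, right_smul, left_pair, right_pair, Pi.smul_apply,
      RingHom.id_apply, smul_eq_mul] <;> module

theorem quatL_apply (v : Fin 4 → ℝ) : quatL n v =
    (v 0 • one (n + 2) + v 2 • iu (n + 1)) + (v 1 • pair (iu n) 0 + v 3 • pair 0 (iu n)) := by
  apply ext_pair
  · change v 0 • one (n + 1) + v 1 • iu n =
      (v 0 • one (n + 1) + v 2 • (0 : A (n + 1))) + (v 1 • iu n + v 3 • (0 : A (n + 1)))
    module
  · change v 2 • one (n + 1) + v 3 • iu n =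
      (v 0 • (0 : A (n + 1)) + v 2 • one (n + 1)) + (v 1 • (0 : A (n + 1)) + v 3 • iu n)
    module

theorem eq_zero_of_perp_quatL {v : Fin 4 → ℝ} (h1 : Perp (left (quatL n v)))
    (h2 : Perp (right (quatL n v))) : v = 0 := by
  have e1 : re (left (one (n + 1))) = 1 := re_one
  have e2 : re (right (one (n + 1))) = 0 := re_zero
  have e3 : re (left (iu n)) = 0 := re_zero
  have e4 : re (right (iu n)) = 1 := re_one
  obtain ⟨h3, h4⟩ := h1
  obtain ⟨h5, h6⟩ := h2
  simp only [quatL, LinearMap.coe_mk, AddHom.coe_mk, left_pair, right_pair, left_add, right_add,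
    left_smul, right_smul, re_add, re_smul, e1, e2, e3, e4] at h3 h4 h5 h6
  ext i
  fin_cases i <;> simp <;> linarith

theorem quatL_mem_Eig_one {ε : ℝ} (hε : ε * ε = 1) {p : A (n + 1)} (h0 : p ≠ 0) (hp : Perp p)
    (v : Fin 4 → ℝ) : quatL n v ∈ Eig 1 (br ε p) := by
  rw [quatL_apply]
  have hb := br_ne_zero (ε := ε) h0
  exact add_mem (add_mem (Submodule.smul_mem _ _ (one_mem_Eig_one hb))
    (Submodule.smul_mem _ _ (iu_mem_Eig_one hb)))
    (add_mem (Submodule.smul_mem _ _ (iu_zero_mem_Eig_one hε h0 hp))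
      (Submodule.smul_mem _ _ (zero_iu_mem_Eig_one hε h0 hp)))

theorem perp_mul_quatL {ε : ℝ} (hε : ε * ε = 1) {p : A (n + 1)} (hp : Perp p) (v : Fin 4 → ℝ) :
    Perp (left (mul (br ε p) (quatL n v))) ∧ Perp (right (mul (br ε p) (quatL n v))) := by
  have hip := hp.iu_mul
  have hiip := hip.iu_mul
  have e1 : ∀ δ : ℝ, ∀ q : A (n + 1), left (br δ q) = q := fun _ _ => rfl
  have e2 : ∀ δ : ℝ, ∀ q : A (n + 1), right (br δ q) = δ • mul (iu n) q := fun _ _ => rfl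
  rw [quatL_apply, mul_add, mul_add, mul_add, mul_smul, mul_smul, mul_smul, mul_smul, mul_one,
    mul_iu, br_mul_iu_zero ε hp, br_mul_zero_iu ε hε]
  simp only [left_add, right_add, left_smul, right_smul, left_neg, right_neg, left_pair, right_pair,
    e1, e2]
  exact ⟨((hp.smul _).add ((hip.smul _).neg.smul _)).add ((hip.neg.smul _).add ((hp.smul _).smul _)),
    (((hip.smul _).smul _).add (hp.smul _)).add
      (((hiip.smul _).neg.smul _).add (((hip.smul _).smul _).smul _))⟩

/-- `C × C` lies in `Eig_1`, where `L_a` is injective, and its image has components orthogonal to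
`C`. The two 4-dimensional spaces are therefore independent. -/
theorem eight_le_finrank_Eig_one_br {ε : ℝ} (hε : ε * ε = 1) {p : A (n + 1)} (h0 : p ≠ 0)
    (hp : Perp p) : 8 ≤ Module.finrank ℝ (Eig 1 (br ε p)) := by
  have hb := br_ne_zero (ε := ε) h0
  have key := LinearMap.finrank_le_finrank_of_injective
    (f := ((quatL n).coprod (L (br ε p) ∘ₗ quatL n)).codRestrict (Eig 1 (br ε p)) fun v =>
      add_mem (quatL_mem_Eig_one hε h0 hp v.1)
        (mul_mem_Eig hb (perp_br ε hp).conj_eq (quatL_mem_Eig_one hε h0 hp v.2))) ?_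
  · simpa [Module.finrank_prod] using key
  · rw [← LinearMap.ker_eq_bot, LinearMap.ker_eq_bot']
    rintro ⟨v, w⟩ h
    have h' : quatL n v + mul (br ε p) (quatL n w) = 0 := congrArg Subtype.val h
    obtain ⟨h1, h2⟩ := perp_mul_quatL hε hp w
    have h3 : quatL n v = -mul (br ε p) (quatL n w) := eq_neg_of_add_eq_zero_left h'
    have hv : v = 0 := eq_zero_of_perp_quatL (by rw [h3]; exact h1.neg) (by rw [h3]; exact h2.neg)
    rw [hv, map_zero, zero_add] at h'
    have h4 : quatL n w = 0 := innerR_self_eq_zero.1 <|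
      innerR_eq_zero_of_mem_Eig zero_ne_one ((mem_Eig_zero hb).2 h') (quatL_mem_Eig_one hε h0 hp w)
    have hz : Perp (0 : A (n + 1)) := ⟨re_zero, re_zero⟩
    rw [hv, eq_zero_of_perp_quatL (v := w) (by rw [h4]; exact hz) (by rw [h4]; exact hz)]
    rfl

end LowerBounds

theorem sum_finrank_eigenspace_le {V : Type*} [AddCommGroup V] [Module ℝ V] [Module.Finite ℝ V]
    (f : Module.End ℝ V) (s : Finset ℝ) :
    ∑ r ∈ s, Module.finrank ℝ (f.eigenspace r) ≤ Module.finrank ℝ V := by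
  suffices h : ∑ r ∈ s, Module.finrank ℝ (f.eigenspace r) =
      Module.finrank ℝ (⨆ r ∈ s, f.eigenspace r : Submodule ℝ V) from
    h.trans_le (Submodule.finrank_le _)
  induction s using Finset.induction_on with
  | empty =>
    have h : (⨆ r ∈ (∅ : Finset ℝ), f.eigenspace r) = ⊥ := by simp
    rw [h, Finset.sum_empty, finrank_bot]
  | insert r s hr ih =>
    have hd : Disjoint (f.eigenspace r) (⨆ t ∈ s, f.eigenspace t) :=
      f.eigenspaces_iSupIndep.disjoint_biSup (y := (s : Set ℝ)) hr
    have h := Submodule.finrank_sup_add_finrank_inf_eq (f.eigenspace r) (⨆ t ∈ s, f.eigenspace t)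
    rw [hd.eq_bot, finrank_bot, add_zero] at h
    rw [Finset.sum_insert hr, ih, Finset.iSup_insert, h]

/-! ### The octonions `A_3` and the base case `A_4` -/

section SmallAlgebras

variable {n : ℕ}

theorem mul_comm_succ (hc : ∀ x y : A n, mul x y = mul y x) (hs : ∀ x : A n, conj x = x)
    (x y : A (n + 1)) : mul x y = mul y x := by
  apply ext_pair <;> simp only [mul_succ, left_pair, right_pair, hs]
  · rw [hc (left x), hc (right y)]
  · rw [add_comm]

theorem mul_assoc_succ (hc : ∀ x y : A n, mul x y = mul y x)
    (ha : ∀ x y z : A n, mul (mul x y) z = mul x (mul y z))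
    (x y z : A (n + 1)) : mul (mul x y) z = mul x (mul y z) := by
  have hlc : ∀ x y z : A n, mul x (mul y z) = mul y (mul x z) := fun x y z => by
    rw [← ha, hc x, ha]
  apply ext_pair <;>
    simp only [mul_succ, left_pair, right_pair, conj_sub, conj_add, conj_mul, conj_conj,
      mul_add, mul_sub, ha, hc, hlc] <;> abel

theorem conj_mul_mul_self_succ (ha : ∀ x y z : A n, mul (mul x y) z = mul x (mul y z))
    (x y : A (n + 1)) : mul (conj x) (mul x y) = innerR x x • y := by
  have h1 : ∀ u v : A n, mul u (mul (conj u) v) = innerR u u • v := fun u v => by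
    rw [← ha, mul_conj_self, smul_mul, one_mul]
  have h2 : ∀ u v : A n, mul (conj u) (mul u v) = innerR u u • v := fun u v => by
    rw [← ha, conj_mul_self, smul_mul, one_mul]
  apply ext_pair <;>
    simp only [conj_succ, mul_succ, left_pair, right_pair, conj_sub, conj_add, conj_mul, conj_conj,
      add_mul, mul_sub, neg_mul, mul_neg, ha, h1, h2, mul_conj_self,
      conj_mul_self, mul_smul, mul_one, innerR_succ, left_smul, right_smul] <;> module

theorem mul_comm_one (x y : A 1) : mul x y = mul y x :=
  mul_comm_succ (n := 0) (_root_.mul_comm (G := ℝ)) (fun _ => rfl) x y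

theorem mul_assoc_one (x y z : A 1) : mul (mul x y) z = mul x (mul y z) :=
  mul_assoc_succ (n := 0) (_root_.mul_comm (G := ℝ)) (_root_.mul_assoc (G := ℝ)) x y z

theorem mul_assoc_two (x y z : A 2) : mul (mul x y) z = mul x (mul y z) :=
  mul_assoc_succ mul_comm_one mul_assoc_one x y z

theorem conj_mul_mul_self (x y : A 3) : mul (conj x) (mul x y) = innerR x x • y :=
  conj_mul_mul_self_succ mul_assoc_two x y

theorem mul_mul_conj_self (x y : A 3) : mul (mul y x) (conj x) = innerR x x • y := by
  have h := congrArg conj (conj_mul_mul_self (conj x) (conj y))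
  simpa only [conj_mul, conj_conj, conj_smul, innerR_conj_conj] using h

theorem Eig_one_eq_top_of_three {a : A 3} (ha : a ≠ 0) : Eig 1 a = ⊤ := by
  rw [eq_top_iff]
  intro x _
  rw [mem_Eig_iff ha, _root_.one_mul, conj_mul_mul_self]

theorem conj_eq_sub (x : A n) : conj x = (2 * re x) • one n - x := by
  rw [← add_conj]; abel

theorem mul_self_eq (x : A n) : mul x x = (2 * re x) • x - innerR x x • one n := by
  rw [← conj_mul_self, conj_eq_sub, sub_mul, smul_mul, one_mul]; abel

theorem mul_left_alt (x y : A 3) : mul x (mul x y) = mul (mul x x) y := by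
  have h1 := conj_mul_mul_self x y
  rw [conj_eq_sub, sub_mul, smul_mul, one_mul] at h1
  rw [mul_self_eq, sub_mul, smul_mul, smul_mul, one_mul, ← h1]; abel

theorem mul_right_alt (x y : A 3) : mul (mul y x) x = mul y (mul x x) := by
  have h := congrArg conj (mul_left_alt (conj x) (conj y))
  simpa only [conj_mul, conj_conj] using h

/-- The linear map `z ↦ (u z) v - u (z v)`. -/
noncomputable def assocL (u v : A n) : A n →ₗ[ℝ] A n where
  toFun z := mul (mul u z) v - mul u (mul z v)
  map_add' x y := by simp only [mul_add, add_mul]; abel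
  map_smul' r x := by simp only [mul_smul, smul_mul, smul_sub, RingHom.id_apply]

theorem assocL_apply (u v z : A n) : assocL u v z = mul (mul u z) v - mul u (mul z v) := rfl

/-- Flexibility, obtained by linearizing the left alternative law and cancelling with the right one.
-/
theorem assocL_self (u : A 3) : assocL u u = 0 := by
  ext z : 1
  have h1 := mul_left_alt (u + z) u
  simp only [mul_add, add_mul] at h1
  rw [assocL_apply, LinearMap.zero_apply]
  linear_combination (norm := module) mul_left_alt u u + mul_left_alt z u - h1 - mul_right_alt u z

/-- The kernel contains `1, u, v, uv` by alternativity. These are independent unless `u` is real or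
`v ∈ span(1, u)`, and in those cases the map vanishes identically. -/
theorem four_le_finrank_ker_assocL (u v : A 3) :
    4 ≤ Module.finrank ℝ (LinearMap.ker (assocL u v)) := by
  have htop : assocL u v = 0 → 4 ≤ Module.finrank ℝ (LinearMap.ker (assocL u v)) := fun h => by
    rw [h, LinearMap.ker_zero, finrank_top, finrank_A]; norm_num
  by_cases hu : ∃ r : ℝ, u = r • one 3
  · obtain ⟨r, rfl⟩ := hu
    refine htop (LinearMap.ext fun z => ?_)
    rw [assocL_apply, smul_mul, smul_mul, smul_mul, one_mul, one_mul, sub_self]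
    rfl
  by_cases hv : ∃ r s : ℝ, v = r • one 3 + s • u
  · obtain ⟨r, s, rfl⟩ := hv
    refine htop (LinearMap.ext fun z => ?_)
    have h := LinearMap.congr_fun (assocL_self u) z
    rw [assocL_apply, LinearMap.zero_apply] at h
    simp only [assocL_apply, mul_add, mul_smul, mul_one, LinearMap.zero_apply]
    linear_combination (norm := module) s • h
  have hone : one 3 ≠ 0 := fun h => by
    have := congrArg re h
    rw [re_one, re_zero] at this
    exact one_ne_zero this
  have hu0 : ∀ r s : ℝ, r • one 3 + s • u = 0 → r = 0 ∧ s = 0 := fun r s h => by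
    have hs : s = 0 := by
      by_contra hs
      refine hu ⟨-(s⁻¹ * r), ?_⟩
      have h' := congrArg (s⁻¹ • ·) h
      simp only [smul_add, smul_smul, inv_mul_cancel₀ hs, smul_zero] at h'
      linear_combination (norm := module) h'
    rw [hs, zero_smul, add_zero] at h
    exact ⟨(smul_eq_zero.1 h).resolve_right hone, hs⟩
  have hmem : ∀ i, ![one 3, u, v, mul u v] i ∈ LinearMap.ker (assocL u v) := by
    intro i
    rw [LinearMap.mem_ker, assocL_apply]
    fin_cases i
    · change mul (mul u (one 3)) v - mul u (mul (one 3) v) = 0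
      rw [mul_one, one_mul, sub_self]
    · exact sub_eq_zero.2 (mul_left_alt u v).symm
    · exact sub_eq_zero.2 (mul_right_alt v u)
    · change mul (mul u (mul u v)) v - mul u (mul (mul u v) v) = 0
      rw [mul_left_alt, mul_right_alt, mul_right_alt, mul_left_alt, sub_self]
  have hli : LinearIndependent ℝ fun i => (⟨_, hmem i⟩ : LinearMap.ker (assocL u v)) := by
    rw [Fintype.linearIndependent_iff]
    intro c hc
    have hc' : c 0 • one 3 + c 1 • u + c 2 • v + c 3 • mul u v = 0 := by
      have := congrArg Subtype.val hc
      simpa [Fin.sum_univ_four] using this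
    set w : A 3 := c 2 • one 3 + c 3 • u with hw
    have hwv : mul w v = -(c 0 • one 3 + c 1 • u) := by
      rw [hw, add_mul, smul_mul, smul_mul, one_mul]
      linear_combination (norm := module) hc'
    -- A linear relation reads `wv ∈ span(1, u)` with `w ∈ span(1, u)`. If `w ≠ 0`, then `v = ‖w‖⁻²
    -- w^*(wv)` lies in `span(1, u)` too, since `u²` does.
    by_cases hw0 : w = 0
    · obtain ⟨h2, h3⟩ := hu0 _ _ hw0
      rw [hw0, zero_mul] at hwv
      obtain ⟨h0, h1⟩ := hu0 _ _ (neg_eq_zero.1 hwv.symm)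
      intro i
      fin_cases i <;> assumption
    · refine absurd ?_ hv
      have hN := innerR_self_ne_zero hw0
      have h := conj_mul_mul_self w v
      rw [hwv, conj_eq_sub] at h
      generalize 2 * re w = k at h
      rw [← inv_smul_eq_iff₀ hN] at h
      refine ⟨(innerR w w)⁻¹ * -((k - c 2) * c 0 + c 3 * c 1 * innerR u u),
        (innerR w w)⁻¹ * -((k - c 2) * c 1 - c 3 * c 0 - c 3 * c 1 * (2 * re u)), ?_⟩
      rw [← h]
      generalize innerR w w = N
      rw [hw]
      simp only [mul_neg, mul_add, sub_mul, add_mul, smul_mul, mul_smul, one_mul, mul_one,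
        mul_self_eq]
      module
  simpa using hli.fintype_card_le_finrank

/-- Conjugation as a linear map. -/
noncomputable def conjL (n : ℕ) : A n →ₗ[ℝ] A n where
  toFun := conj
  map_add' := conj_add
  map_smul' := conj_smul

/-- By alternativity the diagonal blocks of `L_{a^*} L_a` are `‖a‖²`; the rest is off-diagonal and
built from associators. -/
theorem mem_Eig_four {a w : A 4} (ha : a ≠ 0) {lam : ℝ} : w ∈ Eig lam a ↔
    assocL (conj (left a)) (right a) (conj (right w)) = ((lam - 1) * innerR a a) • left w ∧
    assocL (right a) (conj (left a)) (conj (left w)) = ((lam - 1) * innerR a a) • right w := by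
  have h : mul (conj a) (mul a w) = innerR a a • w +
      pair (assocL (conj (left a)) (right a) (conj (right w)))
        (assocL (right a) (conj (left a)) (conj (left w))) := by
    obtain ⟨b, c, rfl⟩ : ∃ b c, a = pair b c := ⟨left a, right a, rfl⟩
    obtain ⟨x, y, rfl⟩ : ∃ x y, w = pair x y := ⟨left w, right w, rfl⟩
    have h1 := mul_mul_conj_self (conj c) x
    have h2 := mul_mul_conj_self b y
    have h3 := conj_mul_mul_self (conj c) y
    have h4 := conj_mul_mul_self b x
    rw [innerR_conj_conj, conj_conj] at h1 h3
    rw [innerR_succ]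
    apply ext_pair
    · simp only [conj_pair, mul_pair, left_pair, right_pair, conj_add, conj_mul, conj_conj,
        left_add, left_smul, assocL_apply, add_mul, mul_sub, mul_neg, neg_mul, h1, h4]
      module
    · simp only [conj_pair, mul_pair, left_pair, right_pair, conj_sub, conj_mul, conj_conj,
        right_add, right_smul, assocL_apply, add_mul, mul_sub, mul_neg, neg_mul, h2, h3]
      module
  rw [mem_Eig_iff ha, h, ← eq_sub_iff_add_eq', ← sub_smul,
    show lam * innerR a a - innerR a a = (lam - 1) * innerR a a by ring]
  exact ⟨fun h => ⟨congrArg left h, congrArg right h⟩, fun h => ext_pair h.1 h.2⟩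

theorem eight_le_finrank_Eig_one_four {a : A 4} (ha : a ≠ 0) :
    8 ≤ Module.finrank ℝ (Eig 1 a) := by
  have h1 := four_le_finrank_ker_assocL (conj (left a)) (right a)
  have h2 := four_le_finrank_ker_assocL (right a) (conj (left a))
  have key := LinearMap.finrank_le_finrank_of_injective
    (f := ((prodEquiv 3).symm.toLinearMap ∘ₗ
      (((conjL 3) ∘ₗ (LinearMap.ker (assocL (right a) (conj (left a)))).subtype).prodMap
        ((conjL 3) ∘ₗ (LinearMap.ker (assocL (conj (left a)) (right a))).subtype))).codRestrict
        (Eig 1 a) fun v => by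
          rw [mem_Eig_four ha, sub_self, MulZeroClass.zero_mul, zero_smul, zero_smul]
          constructor
          · change assocL _ _ (conj (conj v.2.1)) = 0
            rw [conj_conj]; exact v.2.2
          · change assocL _ _ (conj (conj v.1.1)) = 0
            rw [conj_conj]; exact v.1.2) ?_
  · rw [Module.finrank_prod] at key
    omega
  · intro v w h
    have h3 : conj v.1.1 = conj w.1.1 := congrArg (fun t : Eig 1 a => left t.1) h
    have h4 : conj v.2.1 = conj w.2.1 := congrArg (fun t : Eig 1 a => right t.1) h
    refine Prod.ext (Subtype.ext ?_) (Subtype.ext ?_)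
    · rw [← conj_conj v.1.1, h3, conj_conj]
    · rw [← conj_conj v.2.1, h4, conj_conj]

/-- The reflection `(x, y) ↦ (x, -y)`. -/
noncomputable def reflL (n : ℕ) : A (n + 1) →ₗ[ℝ] A (n + 1) where
  toFun w := pair (left w) (-right w)
  map_add' x y := by
    apply ext_pair <;> simp only [left_add, right_add, left_pair, right_pair, neg_add]
  map_smul' r x := by
    apply ext_pair <;> simp only [left_smul, right_smul, left_pair, right_pair, RingHom.id_apply,
      smul_neg]

/-- The reflection reverses the off-diagonal part `M_a - 1`, exchanging eigenvalues `λ` and `2 - λ`.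
-/
theorem finrank_Eig_zero_le_two {a : A 4} (ha : a ≠ 0) :
    Module.finrank ℝ (Eig 0 a) ≤ Module.finrank ℝ (Eig 2 a) := by
  have key := finrank_le_add_of_injOn (Eig 0 a) (0 : A 4 →ₗ[ℝ] Fin 0 → ℝ) (reflL 3) (Eig 2 a) ?_ ?_
  · simpa using key
  · intro w hw _
    rw [mem_Eig_four ha] at hw ⊢
    change assocL _ _ (conj (-right w)) = _ • left w ∧ assocL _ _ (conj (left w)) = _ • -right w
    rw [conj_neg, map_neg, hw.1, hw.2]
    constructor <;> module
  · intro w _ _ h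
    have h1 : left w = 0 := congrArg left (show reflL 3 w = 0 from h)
    have h2 : -right w = 0 := congrArg right (show reflL 3 w = 0 from h)
    exact ext_pair h1 (neg_eq_zero.1 h2)

theorem finrank_Eig_zero_four_le {a : A 4} (ha : a ≠ 0) : Module.finrank ℝ (Eig 0 a) ≤ 4 := by
  have h1 := eight_le_finrank_Eig_one_four ha
  have h2 := finrank_Eig_zero_le_two ha
  have h3 := sum_finrank_eigenspace_le (M a) {0, 1, 2}
  rw [Finset.sum_insert (by norm_num), Finset.sum_insert (by norm_num), Finset.sum_singleton,
    finrank_A] at h3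
  change Module.finrank ℝ (Eig 0 a) + (Module.finrank ℝ (Eig 1 a) +
    Module.finrank ℝ (Eig 2 a)) ≤ 2 ^ 4 at h3
  omega

end SmallAlgebras

/-! ### Induction on `n` and the final dimension count -/

theorem four_mul_le_two_pow {m : ℕ} (hm : 4 ≤ m) : 4 * m ≤ 2 ^ m := by
  induction m, hm using Nat.le_induction with
  | base => norm_num
  | succ m hm ih => rw [pow_succ]; omega

/-- When both `p` and `q` are nonzero the kernel has dimension at most `2^(m+2) - 8m + 6`, short of
`2^(m+2) - 4m - 4` because `m ≥ 3`. -/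
theorem exists_br_of_finrank_Eig_zero {m : ℕ} (hm : 3 ≤ m)
    (ih : ∀ p : A (m + 1), p ≠ 0 → Module.finrank ℝ (Eig 0 p) + 4 * (m + 1) ≤ 2 ^ (m + 1) + 4)
    {a : A (m + 2)} (ha : a ≠ 0)
    (h : 2 ^ (m + 2) + 4 ≤ Module.finrank ℝ (Eig 0 a) + 4 * (m + 2)) :
    ∃ (ε : ℝ) (p : A (m + 1)), ε * ε = 1 ∧ p ≠ 0 ∧ Perp p ∧ a = br ε p := by
  have h2 := four_mul_le_two_pow (m := m + 1) (by omega)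
  rw [pow_succ 2 (m + 1), Eig_zero_eq_ker ha] at h
  by_cases hperp : Perp (left a) ∧ Perp (right a)
  · have hp := perp_cmp 1 hperp.1 hperp.2
    have hq := perp_cmp (-1) hperp.1 hperp.2
    have hdec := br_cmp_add_br_cmp (_root_.one_mul (1 : ℝ)) a
    generalize cmp 1 a = p at hp hdec
    generalize cmp (-1) a = q at hq hdec
    by_cases hp0 : p = 0
    · rw [hp0, br_zero, zero_add] at hdec
      exact ⟨-1, q, by norm_num, fun h0 => ha (by rw [← hdec, h0, br_zero]), hq, hdec.symm⟩
    by_cases hq0 : q = 0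
    · rw [hq0, br_zero, add_zero] at hdec
      exact ⟨1, p, by norm_num, hp0, hp, hdec.symm⟩
    have h3 := finrank_ker_br_add_br hp hq (Or.inl hp0)
    have h4 := ih p hp0
    have h5 := ih q hq0
    rw [Eig_zero_eq_ker hp0] at h4
    rw [Eig_zero_eq_ker hq0] at h5
    rw [hdec] at h3
    omega
  · have := finrank_ker_of_not_perp ha hperp
    omega

/-- The annihilator of a nonzero element of `A_n`, `n ≥ 4`, has dimension at most
`2^n - 4n + 4`. -/
theorem finrank_Eig_zero_le {m : ℕ} (hm : 3 ≤ m) (a : A (m + 1)) (ha : a ≠ 0) :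
    Module.finrank ℝ (Eig 0 a) + 4 * (m + 1) ≤ 2 ^ (m + 1) + 4 := by
  induction m, hm using Nat.le_induction with
  | base => exact Nat.add_le_add_right (finrank_Eig_zero_four_le ha) 16
  | succ m hm ih =>
    by_contra! hlt
    obtain ⟨ε, p, hε, hp0, hp, rfl⟩ := exists_br_of_finrank_Eig_zero hm ih ha hlt.le
    have h1 := finrank_ker_br hε hp0 hp
    change Module.finrank ℝ (LinearMap.ker (L (n := m + 1 + 1) (br ε p))) + 4 ≤ _ at h1
    have h2 := ih p hp0
    rw [Eig_zero_eq_ker ha, pow_succ 2 (m + 1)] at hlt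
    rw [Eig_zero_eq_ker hp0] at h2
    omega

theorem le_finrank_Eig_of_four_le {m : ℕ} (hm : 3 ≤ m) (a : A (m + 1)) (ha : a ≠ 0)
    (h : Module.finrank ℝ (Eig 0 a) + 4 * (m + 1) = 2 ^ (m + 1) + 4) :
    8 ≤ Module.finrank ℝ (Eig 1 a) ∧
      ∀ k < m - 2, 4 ≤ Module.finrank ℝ (Eig (2 ^ (k + 1)) a) := by
  induction m, hm using Nat.le_induction with
  | base =>
    refine ⟨eight_le_finrank_Eig_one_four ha, fun k hk => ?_⟩
    obtain rfl : k = 0 := by omega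
    rw [zero_add, pow_one]
    exact (show 4 ≤ Module.finrank ℝ (Eig 0 a) by omega).trans (finrank_Eig_zero_le_two ha)
  | succ m hm ih =>
    obtain ⟨ε, p, hε, hp0, hp, rfl⟩ :=
      exists_br_of_finrank_Eig_zero hm (fun p hp => finrank_Eig_zero_le hm p hp) ha h.ge
    have h1 := finrank_ker_br hε hp0 hp
    change Module.finrank ℝ (LinearMap.ker (L (n := m + 1 + 1) (br ε p))) + 4 ≤ _ at h1
    have h2 := finrank_Eig_zero_le hm p hp0
    rw [Eig_zero_eq_ker ha, pow_succ 2 (m + 1)] at h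
    rw [← Eig_zero_eq_ker hp0] at h1
    -- The upper bounds for `br ε p` and for `p` combine to the assumed value, so `p` attains its
    -- own bound.
    obtain ⟨h3, h4⟩ := ih p hp0 (by omega)
    refine ⟨eight_le_finrank_Eig_one_br hε hp0 hp, fun k hk => ?_⟩
    rw [pow_succ']
    refine le_trans ?_ (finrank_Eig_inf_quatPerp_le hε hp0 hp (2 ^ k))
    -- Eigenvalue 2 arises from `Eig_1` of `p`, where 4 of at least 8 dimensions may be lost; the
    -- higher powers arise from eigenvalues other than 1, without loss.
    rcases k with _ | k
    · have := finrank_Eig_le_add_four 1 p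
      rw [pow_zero]
      omega
    · rw [inf_eq_left.2 (Eig_le_quatPerp hp0 hp
        (one_lt_pow₀ one_lt_two (Nat.succ_ne_zero k)).ne')]
      exact h4 k (by omega)

theorem le_finrank_Eig {m : ℕ} (a : A (m + 3)) (ha : a ≠ 0)
    (h : Module.finrank ℝ (Eig 0 a) + 4 * (m + 3) = 2 ^ (m + 3) + 4) :
    8 ≤ Module.finrank ℝ (Eig 1 a) ∧
      ∀ k < m, 4 ≤ Module.finrank ℝ (Eig (2 ^ (k + 1)) a) := by
  rcases m with _ | m
  · refine ⟨?_, fun k hk => absurd hk (Nat.not_lt_zero k)⟩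
    rw [Eig_one_eq_top_of_three ha, finrank_top, finrank_A]; norm_num
  · exact le_finrank_Eig_of_four_le (m := m + 3) (by omega) a ha h

theorem hasEigenvalue_iff_finrank {n : ℕ} {a : A n} {lam : ℝ} :
    Module.End.HasEigenvalue (M a) lam ↔ Module.finrank ℝ (Eig lam a) ≠ 0 := by
  rw [ne_eq, Submodule.finrank_eq_zero]; rfl

theorem finrank_Eig_of_top_dim {m : ℕ} (a : A (m + 3)) (ha : a ≠ 0)
    (h : Module.finrank ℝ (Eig 0 a) + 4 * (m + 3) = 2 ^ (m + 3) + 4) :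
    Module.finrank ℝ (Eig 1 a) = 8 ∧
      (∀ k < m, Module.finrank ℝ (Eig (2 ^ (k + 1)) a) = 4) ∧
      ∀ lam : ℝ, lam ≠ 0 → (∀ k ≤ m, lam ≠ 2 ^ k) → Module.finrank ℝ (Eig lam a) = 0 := by
  obtain ⟨h1, h2⟩ := le_finrank_Eig a ha h
  have hinj : Function.Injective fun k : ℕ => (2 : ℝ) ^ k :=
    pow_right_injective₀ two_pos (by norm_num)
  set s : Finset ℝ := (Finset.range (m + 1)).image fun k => (2 : ℝ) ^ k with hs
  have hs0 : (0 : ℝ) ∉ s := by simp [hs]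
  have hsum : ∑ r ∈ insert 0 s, Module.finrank ℝ (Eig r a) =
      Module.finrank ℝ (Eig 0 a) + (∑ k ∈ Finset.range m, Module.finrank ℝ (Eig (2 ^ (k + 1)) a) +
        Module.finrank ℝ (Eig 1 a)) := by
    rw [Finset.sum_insert hs0, hs, Finset.sum_image fun _ _ _ _ e => hinj e,
      Finset.sum_range_succ', pow_zero]
  have hge : ∑ _k ∈ Finset.range m, 4 ≤
      ∑ k ∈ Finset.range m, Module.finrank ℝ (Eig (2 ^ (k + 1)) a) :=
    Finset.sum_le_sum fun k hk => h2 k (Finset.mem_range.1 hk)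
  have hle := sum_finrank_eigenspace_le (M a) (insert 0 s)
  change ∑ r ∈ insert 0 s, Module.finrank ℝ (Eig r a) ≤ _ at hle
  rw [finrank_A, hsum] at hle
  have h4 : ∑ _k ∈ Finset.range m, 4 = m * 4 := by simp
  -- The lower bounds already sum to the full dimension `2^(m+3)`, so each is an equality, and
  -- adjoining a further eigenvalue to the sum leaves it dimension 0.
  refine ⟨by omega, fun k hk => ?_, fun lam hl0 hl => ?_⟩
  · exact ((Finset.sum_eq_sum_iff_of_le fun k hk => h2 k (Finset.mem_range.1 hk)).1 (by omega) k
      (Finset.mem_range.2 hk)).symm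
  · have hlam : lam ∉ insert 0 s := by
      rw [Finset.mem_insert, hs, Finset.mem_image]
      rintro (h0 | ⟨k, hk, hk'⟩)
      · exact hl0 h0
      · exact hl k (Nat.lt_succ_iff.1 (Finset.mem_range.1 hk)) hk'.symm
    have hle' := sum_finrank_eigenspace_le (M a) (insert lam (insert 0 s))
    rw [Finset.sum_insert hlam, finrank_A] at hle'
    change Module.finrank ℝ (Eig lam a) + ∑ r ∈ insert 0 s, Module.finrank ℝ (Eig r a) ≤ _ at hle'
    rw [hsum] at hle'
    omega

end CayleyDickson

theorem mainTheorem1 (n : ℕ) (hn : 3 ≤ n) (a : CayleyDickson.A n)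
    (ha : CayleyDickson.IsTopDimZeroDivisor a) :
    (∀ lam : ℝ, Module.End.HasEigenvalue (CayleyDickson.M a) lam ↔
      (lam = 0 ∧ 4 ≤ n) ∨ ∃ k : ℕ, k ≤ n - 3 ∧ lam = 2 ^ k) ∧
    (Module.finrank ℝ (CayleyDickson.Eig 0 a) : ℤ) = 2 ^ n - 4 * n + 4 ∧
    Module.finrank ℝ (CayleyDickson.Eig 1 a) = 8 ∧
    (∀ lam : ℝ, Module.End.HasEigenvalue (CayleyDickson.M a) lam → lam ≠ 0 → lam ≠ 1 →
      Module.finrank ℝ (CayleyDickson.Eig lam a) = 4) := by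
  obtain ⟨ha0, hdim⟩ := ha
  obtain ⟨m, rfl⟩ : ∃ m, n = m + 3 := ⟨n - 3, by omega⟩
  have h : Module.finrank ℝ (CayleyDickson.Eig 0 a) + 4 * (m + 3) = 2 ^ (m + 3) + 4 := by
    zify
    push_cast at hdim
    linarith
  obtain ⟨h1, h2, h3⟩ := CayleyDickson.finrank_Eig_of_top_dim a ha0 h
  refine ⟨fun lam => ?_, hdim, h1, fun lam hlam hl0 hl1 => ?_⟩
  · rw [CayleyDickson.hasEigenvalue_iff_finrank, Nat.add_sub_cancel]
    constructor
    · intro hne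
      by_contra! hcon
      obtain ⟨hc1, hc2⟩ := hcon
      by_cases hl0 : lam = 0
      -- Only for `n = 3` is the top dimension 0, so that 0 is not an eigenvalue.
      · obtain rfl : m = 0 := by have := hc1 hl0; omega
        rw [hl0] at hne
        omega
      · exact hne (h3 lam hl0 hc2)
    · rintro (⟨rfl, hm⟩ | ⟨k, hk, rfl⟩)
      · have := CayleyDickson.four_mul_le_two_pow hm
        omega
      · rcases k with _ | k
        · rw [pow_zero, h1]; norm_num
        · rw [h2 k hk]; norm_num
  · rw [CayleyDickson.hasEigenvalue_iff_finrank] at hlam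
    by_cases hk : ∃ k ≤ m, lam = 2 ^ k
    · obtain ⟨k, hk, rfl⟩ := hk
      rcases k with _ | k
      · exact absurd (pow_zero 2) hl1
      · exact h2 k hk
    · push Not at hk
      exact absurd (h3 lam hl0 hk) hlam
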